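/- Let $S$ be the surface obtained from the regular hexagon centred at the origin, with two horizontal sides, by gluing opposite sides by translations. Label the horizontal sides $A$ and, continuing clockwise from the top side, the other pairs of opposite sides $B$ and $C$. A bi-infinite straight-line trajectory in $S$ that never hits a vertex of the hexagon has a cutting sequence $w\in\{A,B,C\}^{\mathbb Z}$: the labels of the sides it hits, in order (numbered from an arbitrary starting letter). For $i=0,\dots,5$ let $\Sigma_i=[\frac{i\pi}{6},\frac{(i+1)\pi}{6}]$, and let $$\nu_0=\begin{pmatrix}1&0\\0&1\end{pmatrix},\quad \nu_1=\begin{pmatrix}\frac12&\frac{\sqrt3}2\\ \frac{\sqrt3}2&-\frac12\end{pmatrix},\quad \nu_2=\begin{pmatrix}\frac12&\frac{\sqrt3}2\\-\frac{\sqrt3}2&\frac12\end{pmatrix},\quad \nu_3=\begin{pmatrix}-\frac12&\frac{\sqrt3}2\\ \frac{\sqrt3}2&\frac12\end{pmatrix},\quad \nu_4=\begin{pmatrix}-\frac12&\frac{\sqrt3}2\\-\frac{\sqrt3}2&-\frac12\end{pmatrix},\quad \nu_5=\begin{pmatrix}-1&0\\0&1\end{pmatrix}$$ be the isometries that send the directions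 in $\Sigma_i$ to those in $\Sigma_0$. They permute the labels of the sides by $\pi_0=\mathrm{id}$, $\pi_1=(A\,C)$, $\pi_2=(A\,B\,C)$, $\pi_3=(A\,B)$, $\pi_4=(A\,C\,B)$, $\pi_5=(B\,C)$. Let $\mathscr D_i$ be the directed graph $x\rightleftarrows y\rightleftarrows z$ with an additional loop at $z$, where $(x,y,z)$ is $(A,C,B)$, $(C,A,B)$, $(C,B,A)$, $(B,C,A)$, $(B,A,C)$, $(A,B,C)$ for $i=0,\dots,5$. A word $w\in\{A,B,C\}^{\mathbb Z}$ is admissible in $\mathscr D_i$ if it is a bi-infinite path in $\mathscr D_i$; if this holds for exactly one $i$, the normal form of $w$ is $n(w)=\pi_i\cdot w$. A letter of a word is sandwiched if the letters before and after it are equal, and the derived word $w'$ is obtained from $w$ by keeping exactly the sandwiched letters (it is determined up to a shift of the numbering). Let $\gamma=\begin{pmatrix}-1&2\sqrt3\\0&1\end{pmatrix}$. The hexagon Farey map $F$ on $[0,\pi]$ is given on $\Sigma_i$ by the branch $F_i\colon\Sigma_i\to[\frac\pi6,\pi]$, the action of $\gamma\nu_i$ on directions: $F_i(\theta)=\cot^{-1}\!\big(\frac{a\cot\theta+b}{c\cot\theta+d}\big)$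 for $\gamma\nu_i=\begin{pmatrix}a&b\\c&d\end{pmatrix}$, extended continuously where an argument of $\cot^{-1}$ or a value of $\cot$ is infinite, with value $\pi$ at the angles $\theta$ whose image is the horizontal direction. Write $\Sigma[s_0;s_1,\dots,s_k]=F_{s_0}^{-1}F_{s_1}^{-1}\cdots F_{s_k}^{-1}[0,\pi]$. We say that $\theta$ has the hexagon Farey expansion $\theta=[s_0;s_1,s_2,\dots]$ if $s_k\in\{1,\dots,5\}$ for all $k\ge1$, $F^k(\theta)\in\Sigma_{s_k}$ for all $k\ge 0$, and $\bigcap_{k}\Sigma[s_0;s_1,\dots,s_k]=\{\theta\}$. **Theorem.** Let $w$ be a non-periodic cutting sequence. Then the recursion $w_0=w$, $w_{k+1}=n(w_k)'$ is well defined for all $k$: each $w_k$ is admissible in exactly one diagram $\mathscr D_{d_k(w)}$ and each derived word is bi-infinite. The resulting sequence $(d_k(w))_{k\ge0}$ is uniquely determined by $w$. Moreover, there is a $\theta\in[0,\pi]$ with hexagon Farey expansion $$\theta=[d_0(w);d_1(w),d_2(w),\dots],$$ $w$ is the cutting sequence of a trajectory in direction $\theta$, and every trajectory with cutting sequence $w$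 has direction $\theta$ or $\theta+\pi$. -/

import Mathlib

noncomputable section

namespace HexCut

/-- The labels of the three pairs of opposite sides of the hexagon. -/
inductive Letter
  | A
  | B
  | C
  deriving DecidableEq

open Letter

/-- Bi-infinite words in the alphabet `{A, B, C}`. -/
abbrev Word := ℤ → Letter

/-! ### The hexagon with opposite sides glued, and its linear trajectories -/

/-- The unit normal to the two sides labelled `L`, pointing to the top side for `A`; continuing
clockwise one meets the side `B` (upper right) and then the side `C` (lower right). -/
def normal : Letter → ℝ × ℝ
  | A => (0, 1)
  | B => (√3 / 2, 1 / 2)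
  | C => (√3 / 2, -(1 / 2))

/-- The scalar product of a point with the normal to the sides labelled `L`. -/
def height (L : Letter) (p : ℝ × ℝ) : ℝ := (normal L).1 * p.1 + (normal L).2 * p.2

/-- The open regular hexagon of side length `1`, centred at the origin, with two horizontal
sides. Its vertices are the points `(cos (j * π / 3), sin (j * π / 3))`. -/
def hexInterior : Set (ℝ × ℝ) := {p | ∀ L, |height L p| < √3 / 2}

/-- The two sides labelled `L`, without their end points: `ε = 1` gives the one in direction
`normal L`, and `ε = -1` the opposite one. -/
def openSide (L : Letter) (ε : ℤˣ) : Set (ℝ × ℝ) :=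
  {p | height L p = ((ε : ℤ) : ℝ) * (√3 / 2) ∧ ∀ M, M ≠ L → |height M p| < √3 / 2}

/-- The translation that glues the side `(L, ε)` to the opposite side `(L, -ε)`. -/
def glue (L : Letter) (ε : ℤˣ) (p : ℝ × ℝ) : ℝ × ℝ := p - (((ε : ℤ) : ℝ) * √3) • normal L

/-- A bi-infinite linear trajectory, never hitting a vertex, in the surface obtained from the
hexagon by gluing opposite sides by translations. In the hexagon it is a bi-infinite sequence of
chords, all travelled in direction `dir`: the `n`-th chord runs through the interior of the hexagon
from `entry n` to the point `exit n` of the open side `(label n, sign n)`, and the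
trajectory continues from the point of the opposite side to which `exit n` is glued. -/
structure LinearTrajectory where
  dir : ℝ × ℝ
  dir_ne_zero : dir ≠ 0
  entry : ℤ → ℝ × ℝ
  exit : ℤ → ℝ × ℝ
  label : ℤ → Letter
  sign : ℤ → ℤˣ
  straight : ∀ n, ∃ t : ℝ, 0 < t ∧ exit n = entry n + t • dir
  chord_subset : ∀ n, openSegment ℝ (entry n) (exit n) ⊆ hexInterior
  exit_mem : ∀ n, exit n ∈ openSide (label n) (sign n)
  entry_succ : ∀ n, entry (n + 1) = glue (label n) (sign n) (exit n)

/-- The trajectory has direction angle `θ`, measured from the horizontal axis. -/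
def LinearTrajectory.HasDirection (τ : LinearTrajectory) (θ : ℝ) : Prop :=
  ∃ r : ℝ, 0 < r ∧ τ.dir = (r * Real.cos θ, r * Real.sin θ)

/-- The cutting sequence of a trajectory: the labels of the sides that it hits, in order. -/
def LinearTrajectory.cuttingSequence (τ : LinearTrajectory) : Word := τ.label

/-- `w` is the cutting sequence of some trajectory. -/
def IsCuttingSequence (w : Word) : Prop := ∃ τ : LinearTrajectory, τ.cuttingSequence = w

/-- `w` is a periodic word. -/
def IsPeriodic (w : Word) : Prop := ∃ p : ℤ, p ≠ 0 ∧ Function.Periodic w p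

/-! ### Transition diagrams, normal forms, derivation -/

/-- The `i`-th transition diagram has the shape `x ⇄ y ⇄ z` with a loop at `z`; this lists
`(x, y, z)`. -/
def diagram : Fin 6 → Letter × Letter × Letter :=
  ![(A, C, B), (C, A, B), (C, B, A), (B, C, A), (B, A, C), (A, B, C)]

/-- There is an arrow from `L` to `M` in the `i`-th diagram. -/
def Arrow (i : Fin 6) (L M : Letter) : Prop :=
  let x := (diagram i).1
  let y := (diagram i).2.1
  let z := (diagram i).2.2
  (L = x ∧ M = y) ∨ (L = y ∧ M = x) ∨ (L = y ∧ M = z) ∨ (L = z ∧ M = y) ∨ (L = z ∧ M = z)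

/-- `w` is admissible in diagram `i`: it describes a bi-infinite path in that diagram. -/
def Admissible (i : Fin 6) (w : Word) : Prop := ∀ n, Arrow i (w n) (w (n + 1))

/-- The permutations of the labels: the identity, `(A C)`, `(A B C)`, `(A B)`, `(A C B)`,
`(B C)`. -/
def labelPerm : Fin 6 → Equiv.Perm Letter :=
  ![1, Equiv.swap A C, Equiv.swap A B * Equiv.swap B C, Equiv.swap A B,
    Equiv.swap A C * Equiv.swap C B, Equiv.swap B C]

/-- The word obtained from `w` by the `i`-th permutation of the labels. If `i` is the only diagram
in which `w` is admissible, this is the normal form of `w`. -/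
def relabel (i : Fin 6) (w : Word) : Word := fun n => labelPerm i (w n)

/-- The letter of `w` at place `n` is sandwiched: the previous and the following letter agree. -/
def Sandwiched (w : Word) (n : ℤ) : Prop := w (n - 1) = w (n + 1)

/-- `w'` is the derived sequence of `w`: the bi-infinite word that is left when exactly the
sandwiched letters of `w` are kept, in their order. (The numbering of the letters of `w'` is free:
it is determined up to a shift.) -/
def IsDerived (w w' : Word) : Prop :=
  ∃ f : ℤ → ℤ, StrictMono f ∧ Set.range f = {n | Sandwiched w n} ∧ ∀ n, w' n = w (f n)

/-- `d` is the sequence of admissible diagrams of `w`: there are words `w₀ = w, w₁, w₂, …` such that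
`d k` is the one and only diagram in which `wₖ` is admissible, and `wₖ₊₁` is the derived sequence of
the normal form of `wₖ`. -/
def IsDiagramSequence (w : Word) (d : ℕ → Fin 6) : Prop :=
  ∃ W : ℕ → Word, W 0 = w ∧
    ∀ k, (∀ i, Admissible i (W k) ↔ i = d k) ∧ IsDerived (relabel (d k) (W k)) (W (k + 1))

/-! ### The hexagon Farey map -/

/-- The sector `[i * π / 6, (i + 1) * π / 6]` of directions. -/
def sector (i : Fin 6) : Set ℝ :=
  Set.Icc ((i : ℕ) * (Real.pi / 6)) (((i : ℕ) + 1) * (Real.pi / 6))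

/-- The isometries of the hexagon that send the `i`-th sector to the `0`-th sector. -/
def nu : Fin 6 → Matrix (Fin 2) (Fin 2) ℝ :=
  ![!![1, 0; 0, 1],
    !![1 / 2, √3 / 2; √3 / 2, -(1 / 2)],
    !![1 / 2, √3 / 2; -(√3 / 2), 1 / 2],
    !![-(1 / 2), √3 / 2; √3 / 2, 1 / 2],
    !![-(1 / 2), √3 / 2; -(√3 / 2), -(1 / 2)],
    !![-1, 0; 0, 1]]

/-- The orientation reversing Veech element. -/
def gam : Matrix (Fin 2) (Fin 2) ℝ := !![-1, 2 * √3; 0, 1]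

/-- The `i`-th branch of the Farey map, to be used on the `i`-th sector: the action of
`gam * nu i = !![a, b; c, d]` on directions, in the angle coordinate. For `θ` in the `i`-th sector,
the image of `(cos θ, sin θ)` is either in the open upper half plane or on the negative horizontal
axis, so that its argument is in `(0, π]`. This is the continuous function
`cot⁻¹ ((a * cot θ + b) / (c * cot θ + d))` with values in `[0, π]`. -/
def fareyBranch (i : Fin 6) (θ : ℝ) : ℝ :=
  let v := (gam * nu i).mulVec ![Real.cos θ, Real.sin θ]
  Complex.arg ⟨v 0, v 1⟩

/-- A sector that contains the angle `θ ∈ [0, π]`. -/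
def sectorIndex (θ : ℝ) : Fin 6 :=
  if θ ≤ Real.pi / 6 then 0
  else if θ ≤ 2 * (Real.pi / 6) then 1
  else if θ ≤ 3 * (Real.pi / 6) then 2
  else if θ ≤ 4 * (Real.pi / 6) then 3
  else if θ ≤ 5 * (Real.pi / 6) then 4
  else 5

/-- The Farey map on `[0, π]`: it is given by the `i`-th branch on the `i`-th sector (on the common
end point of two neighbouring sectors both branches agree). -/
def fareyMap (θ : ℝ) : ℝ := fareyBranch (sectorIndex θ) θ

/-- The set `Σ[s₀; s₁, …, sₖ] = F_{s₀}⁻¹ F_{s₁}⁻¹ ⋯ F_{sₖ}⁻¹ [0, π]`, where `F_i` is the `i`-th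
branch of the Farey map, defined on the `i`-th sector. -/
def cylinder : ℕ → (ℕ → Fin 6) → Set ℝ
  | 0, s => {θ | θ ∈ sector (s 0) ∧ fareyBranch (s 0) θ ∈ Set.Icc 0 Real.pi}
  | k + 1, s => {θ | θ ∈ sector (s 0) ∧ fareyBranch (s 0) θ ∈ cylinder k (fun j => s (j + 1))}

/-- `θ = [s₀; s₁, s₂, …]` is the angle with hexagon Farey expansion `s`: the digits after the first
are nonzero, `s` is an itinerary of `θ` under the Farey map, and `θ` is the one and only point
of the intersection of the sets `Σ[s₀; s₁, …, sₖ]`. -/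
def HasFareyExpansion (θ : ℝ) (s : ℕ → Fin 6) : Prop :=
  (∀ k, 1 ≤ k → s k ≠ 0) ∧ (∀ k, fareyMap^[k] θ ∈ sector (s k)) ∧ ⋂ k, cylinder k s = {θ}

end HexCut

end

noncomputable section

namespace HexCut

open Letter

/-! ### Orbits of the interval exchange on a transversal -/

/-! Fix a direction `u` and record each exit point `e` of a trajectory by the number `cross u e`.
Along a chord this number is constant, and crossing a side changes it by an amount depending only on
the label. So a cutting sequence is the same thing as the coding of an orbit of an interval exchange
(`LinearTrajectory.isOrbit`, `IsOrbit.exists_trajectory`), and everything becomes linear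
inequalities in the coordinates `(p, q)` of `u`. The map `iso i` carries sector `i` to the cone `0 ≤
p ≤ q`, so it suffices to study exchanges with parameters `(a, c)` in that cone.

A repeated point makes the coding periodic. If `a` and `c` are rationally dependent, a bounded orbit
takes finitely many values, so a non-periodic word forces independence
(`IsOrbit.irr_of_not_isPeriodic`). Independence keeps the direction and all its Farey images off the
sector boundaries. It also makes enough transitions occur to leave only one possible diagram
(`IsOrbit.admissible_iff`).

Renormalization is `IsOrbit.of_isDerived`: up to a reflection and a translation for each letter, the
sandwiched places of an orbit for `(a, c)` form an orbit for `(a, 2 * a - c)`, the image under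
`gam`. Hence if `w` codes the direction `θ`, the derived word of its normal form codes `fareyMap θ`.
By induction the diagram sequence is the itinerary of `θ`.

The itinerary determines `θ`. The maps `veech i` preserve determinants up to sign, while the vectors
obtained from `θ` become arbitrarily small (`exists_add_lt`) and those of another angle in all the
cylinders stay bounded. So the determinant of the two initial vectors is zero
(`cross_eq_zero_of_itinerary`). Since `w` alone determines the itinerary, every trajectory with
cutting sequence `w` has the same `θ`, up to adding `π`. -/

/-- The scalar product of the direction of coordinates `(p, q)` with `normal L`. -/
def nrm (p q : ℝ) : Letter → ℝ
  | A => p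
  | B => p + q
  | C => q

/-- The displacement along the transversal due to the gluing of the sides `L`, up to sign. -/
def twist (p q : ℝ) : Letter → ℝ
  | A => p + 2 * q
  | B => q - p
  | C => -(2 * p + q)

/-- The displacement along the transversal when the trajectory crosses a side `L`. -/
def shift (p q : ℝ) (L : Letter) : ℝ := if 0 < nrm p q L then twist p q L else -twist p q L

/-- `w` is the coding of the orbit `x` of the interval exchange that a linear flow induces on a
transversal of the hexagon; `p`, `q` are the scalar products of the direction with the normals
of the sides `A` and `C`. -/
structure IsOrbit (p q : ℝ) (w : Word) (x : ℤ → ℝ) : Prop where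
  mem : ∀ n, |x n - shift p q (w n) / 2| < |nrm p q (w n)| / 2
  step : ∀ n, x (n + 1) = x n - shift p q (w n)

theorem IsOrbit.nrm_ne_zero {p q : ℝ} {w : Word} {x : ℤ → ℝ} (h : IsOrbit p q w x) (n : ℤ) :
    nrm p q (w n) ≠ 0 := by
  intro h0
  have := h.mem n
  rw [h0, abs_zero, zero_div] at this
  exact absurd this (not_lt.2 (abs_nonneg _))

theorem nrm_smul (r p q : ℝ) (L : Letter) : nrm (r * p) (r * q) L = r * nrm p q L := by
  cases L <;> simp [nrm]
  ring

theorem twist_smul (r p q : ℝ) (L : Letter) : twist (r * p) (r * q) L = r * twist p q L := by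
  cases L <;> simp [twist] <;> ring

theorem IsOrbit.smul {p q : ℝ} {w : Word} {x : ℤ → ℝ} (h : IsOrbit p q w x) {r : ℝ} (hr : 0 < r) :
    IsOrbit (r * p) (r * q) w (fun n => r * x n) := by
  have hs : ∀ L, shift (r * p) (r * q) L = r * shift p q L := by
    intro L
    simp only [shift, nrm_smul, twist_smul, hr, mul_pos_iff_of_pos_left]
    split_ifs <;> ring
  refine ⟨fun n => ?_, fun n => ?_⟩
  · rw [hs, nrm_smul, abs_mul, abs_of_pos hr,
      show r * x n - r * shift p q (w n) / 2 = r * (x n - shift p q (w n) / 2) by ring, abs_mul,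
      abs_of_pos hr, mul_div_assoc]
    exact mul_lt_mul_of_pos_left (h.mem n) hr
  · rw [hs, h.step]; ring

/-- Orbits are transported by a relabelling that multiplies `nrm` and `twist` by signs. -/
theorem IsOrbit.map {p q p' q' : ℝ} {w : Word} {x : ℤ → ℝ} (h : IsOrbit p q w x)
    (π : Letter → Letter) (σ : Letter → ℝ) (κ : ℝ) (hκ : κ = 1 ∨ κ = -1)
    (hσ : ∀ L, σ L = 1 ∨ σ L = -1) (hN : ∀ L, nrm p' q' (π L) = σ L * nrm p q L)
    (hD : ∀ L, twist p' q' (π L) = κ * σ L * twist p q L) :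
    IsOrbit p' q' (fun n => π (w n)) (fun n => κ * x n) := by
  have hs : ∀ n, shift p' q' (π (w n)) = κ * shift p q (w n) := by
    intro n
    have h0 := h.nrm_ne_zero n
    simp only [shift, hN, hD]
    rcases lt_or_gt_of_ne h0 with h1 | h1
    · rcases hσ (w n) with h2 | h2 <;> rw [h2] <;> simp [h1, h1.le, not_lt]
    · rcases hσ (w n) with h2 | h2 <;> rw [h2] <;> simp [h1, h1.le, not_lt]
  refine ⟨fun n => ?_, fun n => ?_⟩
  · have ha : |nrm p' q' (π (w n))| = |nrm p q (w n)| := by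
      rw [hN, abs_mul]; rcases hσ (w n) with h2 | h2 <;> simp [h2]
    have hk : |κ| = 1 := by rcases hκ with h2 | h2 <;> simp [h2]
    rw [ha, hs, show κ * x n - κ * shift p q (w n) / 2 = κ * (x n - shift p q (w n) / 2) by ring,
      abs_mul, hk, one_mul]
    exact h.mem n
  · simp only [hs, h.step]; ring

/-- The half-turn of the hexagon preserves all labels and reverses the direction. It does not change
the transversal coordinate, since both arguments of `cross` change sign. This is why a word cannot
tell `θ` from `θ + π`. -/
theorem IsOrbit.neg {p q : ℝ} {w : Word} {x : ℤ → ℝ} (h : IsOrbit p q w x) :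
    IsOrbit (-p) (-q) w x := by
  have := h.map (p' := -p) (q' := -q) id (fun _ => -1) 1 (Or.inl rfl) (fun _ => Or.inr rfl)
    (by intro L; cases L <;> simp [nrm]; ring) (by intro L; cases L <;> simp [twist] <;> ring)
  simpa using this

/-- The action of `nu i` in the coordinates `(p, q)`. -/
def iso : Fin 6 → ℝ × ℝ → ℝ × ℝ :=
  ![fun v => v, fun v => (v.2, v.1), fun v => (-v.2, v.1 + v.2), fun v => (v.1 + v.2, -v.2),
    fun v => (-(v.1 + v.2), v.1), fun v => (v.1, -(v.1 + v.2))]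

theorem IsOrbit.relabel {p q : ℝ} {w : Word} {x : ℤ → ℝ} (h : IsOrbit p q w x) (i : Fin 6) :
    ∃ y, IsOrbit (iso i (p, q)).1 (iso i (p, q)).2 (relabel i w) y := by
  have hA : ∀ i, labelPerm i A = ![A, C, B, B, C, A] i := by decide
  have hB : ∀ i, labelPerm i B = ![B, B, C, A, A, C] i := by decide
  have hC : ∀ i, labelPerm i C = ![C, A, A, C, B, B] i := by decide
  refine ⟨_, h.map (labelPerm i)
    -- The sign for `L` says whether the isometry sends `normal L` to the normal of the relabelled
    -- side or to its opposite; the factor `κ` is the determinant of `nu i`.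
    (fun L => ![1, 1, (match L with | A => 1 | B => 1 | C => -1),
      (match L with | A => 1 | B => 1 | C => -1), (match L with | A => 1 | B => -1 | C => -1),
      (match L with | A => 1 | B => -1 | C => -1)] i)
    (![1, -1, 1, -1, 1, -1] i) ?_ ?_ ?_ ?_⟩
  · fin_cases i <;> simp
  · intro L; fin_cases i <;> cases L <;> simp
  · intro L
    cases L
    · rw [hA]; fin_cases i <;> simp [iso, nrm]
    · rw [hB]; fin_cases i <;> simp [iso, nrm]; ring
    · rw [hC]; fin_cases i <;> simp [iso, nrm]
  · intro L
    cases L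
    · rw [hA]; fin_cases i <;> simp [iso, twist] <;> ring
    · rw [hB]; fin_cases i <;> simp [iso, twist] <;> ring
    · rw [hC]; fin_cases i <;> simp [iso, twist] <;> ring

theorem admissible_iff_relabel (i : Fin 6) (w : Word) :
    Admissible i w ↔ Admissible 0 (relabel i w) := by
  have : ∀ (i : Fin 6), ∀ L M : Letter, Arrow i L M ↔ Arrow 0 (labelPerm i L) (labelPerm i M) := by
    intro i L M
    fin_cases i <;> cases L <;> cases M <;> unfold Arrow <;> decide
  exact forall_congr' fun n => this i _ _

/-! ### Orbits for directions in the first sector -/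

/-- The alternative for a place of an orbit in a direction of the first sector. -/
theorem IsOrbit.cases {a c : ℝ} (ha : 0 ≤ a) (hac : a ≤ c) {v : Word} {x : ℤ → ℝ}
    (h : IsOrbit a c v x) (n : ℤ) :
    (v n = A ∧ c < x n ∧ x n < a + c ∧ x (n + 1) = x n - (a + 2 * c)) ∨
    (v n = B ∧ -a < x n ∧ x n < c ∧ x (n + 1) = x n - (c - a)) ∨
    (v n = C ∧ -(a + c) < x n ∧ x n < -a ∧ x (n + 1) = x n + (2 * a + c)) := by
  have h0 := h.nrm_ne_zero n
  have h1 := h.mem n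
  have h2 := h.step n
  cases hv : v n <;> simp only [hv, shift, nrm, twist] at h0 h1 h2
  · have : 0 < a := lt_of_le_of_ne ha (Ne.symm h0)
    rw [if_pos this] at h1 h2
    rw [abs_of_pos this, abs_lt] at h1
    exact Or.inl ⟨rfl, by linarith, by linarith, h2⟩
  · have : 0 < a + c := lt_of_le_of_ne (by linarith) (Ne.symm h0)
    rw [if_pos this] at h1 h2
    rw [abs_of_pos this, abs_lt] at h1
    exact Or.inr (Or.inl ⟨rfl, by linarith, by linarith, h2⟩)
  · have : 0 < c := lt_of_le_of_ne (by linarith) (Ne.symm h0)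
    rw [if_pos this] at h1 h2
    rw [abs_of_pos this, abs_lt] at h1
    exact Or.inr (Or.inr ⟨rfl, by linarith, by linarith, by linarith⟩)

/-- The exchange reverses the order of its three intervals; these are their images. -/
theorem IsOrbit.cases_prev {a c : ℝ} (ha : 0 ≤ a) (hac : a ≤ c) {v : Word} {x : ℤ → ℝ}
    (h : IsOrbit a c v x) (n : ℤ) :
    (v (n - 1) = A ∧ -(a + c) < x n ∧ x n < -c) ∨
    (v (n - 1) = B ∧ -c < x n ∧ x n < a) ∨
    (v (n - 1) = C ∧ a < x n ∧ x n < a + c) := by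
  have := h.cases ha hac (n - 1)
  rw [sub_add_cancel] at this
  rcases this with ⟨h1, h2, h3, h4⟩ | ⟨h1, h2, h3, h4⟩ | ⟨h1, h2, h3, h4⟩
  · exact Or.inl ⟨h1, by linarith, by linarith⟩
  · exact Or.inr (Or.inl ⟨h1, by linarith, by linarith⟩)
  · exact Or.inr (Or.inr ⟨h1, by linarith, by linarith⟩)

theorem IsOrbit.admissible {a c : ℝ} (ha : 0 ≤ a) (hac : a ≤ c) {v : Word} {x : ℤ → ℝ}
    (h : IsOrbit a c v x) : Admissible 0 v := by
  intro n
  rcases h.cases ha hac n with ⟨h1, h2, h3, h4⟩ | ⟨h1, h2, h3, h4⟩ | ⟨h1, h2, h3, h4⟩ <;>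
  rcases h.cases ha hac (n + 1) with ⟨k1, k2, k3, -⟩ | ⟨k1, k2, k3, -⟩ | ⟨k1, k2, k3, -⟩ <;>
  first
  | (exfalso; linarith)
  | (rw [h1, k1]; simp [Arrow, diagram])

/-! ### The derived word of an orbit in the first sector -/

/-- The shift of the transversal coordinate between an orbit and its derived orbit. -/
def derivedOffset (a c : ℝ) : Letter → ℝ
  | A => 3 * a
  | B => if c < 3 * a then 0 else c - a
  | C => if c < 2 * a then -(3 * a) else a - c

theorem shift_of_pos {p q : ℝ} {L : Letter} (h : 0 < nrm p q L) : shift p q L = twist p q L :=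
  if_pos h

theorem shift_of_neg {p q : ℝ} {L : Letter} (h : nrm p q L < 0) : shift p q L = -twist p q L :=
  if_neg h.not_gt

/-- The displacements and the offsets of the derived orbit when `c < 2 * a`. -/
theorem derived_values_of_lt {a c : ℝ} (ha : 0 < a) (hac : a < c) (h : c < 2 * a) :
    (shift a (2 * a - c) A = 5 * a - 2 * c ∧ shift a (2 * a - c) B = a - c ∧
      shift a (2 * a - c) C = c - 4 * a) ∧
    derivedOffset a c A = 3 * a ∧ derivedOffset a c B = 0 ∧ derivedOffset a c C = -(3 * a) := by
  refine ⟨⟨?_, ?_, ?_⟩, rfl, if_pos (by linarith), if_pos h⟩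
  · rw [shift_of_pos (by simpa [nrm] using ha)]; simp only [twist]; ring
  · rw [shift_of_pos (by simp only [nrm]; linarith)]; simp only [twist]; ring
  · rw [shift_of_pos (by simp only [nrm]; linarith)]; simp only [twist]; ring

/-- The displacements and the offsets of the derived orbit when `2 * a < c < 3 * a`. -/
theorem derived_values_of_lt_of_gt {a c : ℝ} (ha : 0 < a) (h : 2 * a < c) (h' : c < 3 * a) :
    (shift a (2 * a - c) A = 5 * a - 2 * c ∧ shift a (2 * a - c) B = a - c ∧
      shift a (2 * a - c) C = 4 * a - c) ∧
    derivedOffset a c A = 3 * a ∧ derivedOffset a c B = 0 ∧ derivedOffset a c C = a - c := by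
  refine ⟨⟨?_, ?_, ?_⟩, rfl, if_pos h', if_neg h.not_gt⟩
  · rw [shift_of_pos (by simpa [nrm] using ha)]; simp only [twist]; ring
  · rw [shift_of_pos (by simp only [nrm]; linarith)]; simp only [twist]; ring
  · rw [shift_of_neg (by simp only [nrm]; linarith)]; simp only [twist]; ring

/-- The displacements and the offsets of the derived orbit when `3 * a < c`. -/
theorem derived_values_of_gt {a c : ℝ} (ha : 0 < a) (h : 3 * a < c) :
    (shift a (2 * a - c) A = 5 * a - 2 * c ∧ shift a (2 * a - c) B = c - a ∧
      shift a (2 * a - c) C = 4 * a - c) ∧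
    derivedOffset a c A = 3 * a ∧ derivedOffset a c B = c - a ∧ derivedOffset a c C = a - c := by
  refine ⟨⟨?_, ?_, ?_⟩, rfl, if_neg h.not_gt, if_neg (by linarith)⟩
  · rw [shift_of_pos (by simpa [nrm] using ha)]; simp only [twist]; ring
  · rw [shift_of_neg (by simp only [nrm]; linarith)]; simp only [twist]; ring
  · rw [shift_of_neg (by simp only [nrm]; linarith)]; simp only [twist]; ring

/-- The displacements and the offsets of the derived orbit. -/
theorem derived_values {a c : ℝ} (ha : 0 < a) (hac : a < c) (h2 : c ≠ 2 * a) (h3 : c ≠ 3 * a) :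
    shift a (2 * a - c) A = 5 * a - 2 * c ∧ derivedOffset a c A = 3 * a ∧
    (c < 2 * a ∧ shift a (2 * a - c) B = a - c ∧ shift a (2 * a - c) C = c - 4 * a ∧
        derivedOffset a c B = 0 ∧ derivedOffset a c C = -(3 * a) ∨
      (2 * a < c ∧ c < 3 * a) ∧ shift a (2 * a - c) B = a - c ∧ shift a (2 * a - c) C = 4 * a - c ∧
        derivedOffset a c B = 0 ∧ derivedOffset a c C = a - c ∨
      3 * a < c ∧ shift a (2 * a - c) B = c - a ∧ shift a (2 * a - c) C = 4 * a - c ∧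
        derivedOffset a c B = c - a ∧ derivedOffset a c C = a - c) := by
  rcases lt_or_gt_of_ne h2 with r | r
  · have := derived_values_of_lt ha hac r
    tauto
  rcases lt_or_gt_of_ne h3 with r' | r'
  · have := derived_values_of_lt_of_gt ha r r'
    tauto
  · have := derived_values_of_gt ha r'
    tauto

/-- The places at which a letter is sandwiched, in terms of the transversal coordinate. -/
theorem IsOrbit.sandwiched_bounds {a c : ℝ} (ha : 0 < a) (hac : a < c)
    {v : Word} {x : ℤ → ℝ} (h : IsOrbit a c v x) {n : ℤ} (hn : Sandwiched v n) :
    (v n = A ∧ c < x n ∧ x n < a + c) ∨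
    (v n = B ∧ (c - 2 * a < x n ∧ x n < a ∨ a < x n ∧ x n < c - 2 * a)) ∨
    (v n = C ∧ (-2 * a < x n ∧ x n < -c ∨ -c < x n ∧ x n < -2 * a)) := by
  unfold Sandwiched at hn
  rcases h.cases ha.le hac.le n with ⟨h1, h2, h3, h4⟩ | ⟨h1, h2, h3, h4⟩ | ⟨h1, h2, h3, h4⟩
  · exact Or.inl ⟨h1, h2, h3⟩
  all_goals
    rcases h.cases_prev ha.le hac.le n with ⟨k1, k2, k3⟩ | ⟨k1, k2, k3⟩ | ⟨k1, k2, k3⟩ <;>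
    rcases h.cases ha.le hac.le (n + 1) with ⟨l1, l2, l3, -⟩ | ⟨l1, l2, l3, -⟩ | ⟨l1, l2, l3, -⟩ <;>
    first
    | (rw [k1, l1] at hn; cases hn; done)
    | (exfalso; linarith)
    | exact Or.inr (Or.inl ⟨h1, Or.inl ⟨by linarith, by linarith⟩⟩)
    | exact Or.inr (Or.inl ⟨h1, Or.inr ⟨by linarith, by linarith⟩⟩)
    | exact Or.inr (Or.inr ⟨h1, Or.inl ⟨by linarith, by linarith⟩⟩)
    | exact Or.inr (Or.inr ⟨h1, Or.inr ⟨by linarith, by linarith⟩⟩)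

/-- In each regime, `x ↦ -x + derivedOffset a c L` carries the nonempty interval in
`IsOrbit.sandwiched_bounds` for `L` to the exit interval of `L` in direction `(a, 2 * a - c)`. The
regimes are separated by the zeros of the new `nrm` at `C` and at `B`. -/
theorem IsOrbit.derived_mem {a c : ℝ} (ha : 0 < a) (hac : a < c) (h2 : c ≠ 2 * a) (h3 : c ≠ 3 * a)
    {v : Word} {x : ℤ → ℝ} (h : IsOrbit a c v x) {n : ℤ} (hn : Sandwiched v n) :
    |-x n + derivedOffset a c (v n) - shift a (2 * a - c) (v n) / 2|
      < |nrm a (2 * a - c) (v n)| / 2 := by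
  have key : ∀ {s t u : ℝ}, s - t / 2 < |u| / 2 ∧ t / 2 - s < |u| / 2 → |s - t / 2| < |u| / 2 :=
    fun h => abs_lt.2 ⟨by linarith [h.2], h.1⟩
  rcases lt_or_gt_of_ne h2 with r | r
  · obtain ⟨⟨e1, e2, e3⟩, o1, o2, o3⟩ := derived_values_of_lt ha hac r
    rcases h.sandwiched_bounds ha hac hn with ⟨h1, b1, b2⟩ | ⟨h1, ⟨b1, b2⟩ | ⟨b1, b2⟩⟩ |
      ⟨h1, ⟨b1, b2⟩ | ⟨b1, b2⟩⟩ <;> rw [h1] <;> apply key <;>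
      simp only [nrm, e1, e2, e3, o1, o2, o3]
    · rw [abs_of_pos ha]; constructor <;> linarith
    · rw [abs_of_pos (by linarith : 0 < a + (2 * a - c))]; constructor <;> linarith
    · exfalso; linarith
    · rw [abs_of_pos (by linarith : 0 < 2 * a - c)]; constructor <;> linarith
    · exfalso; linarith
  rcases lt_or_gt_of_ne h3 with r' | r'
  · obtain ⟨⟨e1, e2, e3⟩, o1, o2, o3⟩ := derived_values_of_lt_of_gt ha r r'
    rcases h.sandwiched_bounds ha hac hn with ⟨h1, b1, b2⟩ | ⟨h1, ⟨b1, b2⟩ | ⟨b1, b2⟩⟩ |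
      ⟨h1, ⟨b1, b2⟩ | ⟨b1, b2⟩⟩ <;> rw [h1] <;> apply key <;>
      simp only [nrm, e1, e2, e3, o1, o2, o3]
    · rw [abs_of_pos ha]; constructor <;> linarith
    · rw [abs_of_pos (by linarith : 0 < a + (2 * a - c))]; constructor <;> linarith
    · exfalso; linarith
    · exfalso; linarith
    · rw [abs_of_neg (by linarith : 2 * a - c < 0)]; constructor <;> linarith
  · obtain ⟨⟨e1, e2, e3⟩, o1, o2, o3⟩ := derived_values_of_gt ha r'
    rcases h.sandwiched_bounds ha hac hn with ⟨h1, b1, b2⟩ | ⟨h1, ⟨b1, b2⟩ | ⟨b1, b2⟩⟩ |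
      ⟨h1, ⟨b1, b2⟩ | ⟨b1, b2⟩⟩ <;> rw [h1] <;> apply key <;>
      simp only [nrm, e1, e2, e3, o1, o2, o3]
    · rw [abs_of_pos ha]; constructor <;> linarith
    · exfalso; linarith
    · rw [abs_of_neg (by linarith : a + (2 * a - c) < 0)]; constructor <;> linarith
    · exfalso; linarith
    · rw [abs_of_neg (by linarith : 2 * a - c < 0)]; constructor <;> linarith

/-- `m` is the first sandwiched place of `v` after `k`. -/
def IsNextSandwiched (v : Word) (k m : ℤ) : Prop :=
  k < m ∧ Sandwiched v m ∧ ∀ j, k < j → j < m → ¬ Sandwiched v j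

theorem sandwiched_succ_iff (v : Word) (k : ℤ) :
    Sandwiched v (k + 1) ↔ v k = v (k + 1 + 1) := by
  rw [Sandwiched, add_sub_cancel_right]

theorem isNextSandwiched_succ {v : Word} {k : ℤ} (h : Sandwiched v (k + 1)) :
    IsNextSandwiched v k (k + 1) :=
  ⟨by omega, h, fun j _ _ => by omega⟩

theorem IsNextSandwiched.of_succ {v : Word} {k m : ℤ} (h : IsNextSandwiched v (k + 1) m)
    (hk : ¬ Sandwiched v (k + 1)) : IsNextSandwiched v k m := by
  refine ⟨by have := h.1; omega, h.2.1, fun j h1 h2 => ?_⟩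
  rcases (show j = k + 1 ∨ k + 1 < j by omega) with rfl | h3
  · exact hk
  · exact h.2.2 j h3 h2

/-- After `B C` comes either `B`, which sandwiches `C`, or `A`, whose two neighbours are always `C`.
The searches from `B B` and `C B` reduce to this one. -/
theorem IsOrbit.next_of_B_C {a c : ℝ} (ha : 0 < a) (hac : a < c) {v : Word} {x : ℤ → ℝ}
    (h : IsOrbit a c v x) {k : ℤ} (h0 : v k = B) (h1 : v (k + 1) = C) :
    ∃ m, IsNextSandwiched v k m ∧ m ≤ k + 2 ∧
      (v m = C ∧ x m = x k - (c - a) ∨ v m = A ∧ x m = x k + 3 * a) := by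
  have P := h.cases ha.le hac.le
  have Q0 := P k
  have Q1 := P (k + 1)
  simp only [h0, h1, reduceCtorEq, false_and, false_or, or_false, true_and] at Q0 Q1
  obtain ⟨a1, a2, a3⟩ := Q0
  obtain ⟨b1, b2, b3⟩ := Q1
  rcases P (k + 1 + 1) with ⟨l1, l2, l3, l4⟩ | ⟨l1, l2, l3, l4⟩ | ⟨l1, l2, l3, l4⟩
  · refine ⟨k + 1 + 1, (isNextSandwiched_succ ?_).of_succ ?_, by omega, Or.inr ⟨l1, by linarith⟩⟩
    · rw [sandwiched_succ_iff, h1]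
      rcases P (k + 1 + 1 + 1) with ⟨m1, m2, m3, -⟩ | ⟨m1, m2, m3, -⟩ | ⟨m1, m2, m3, -⟩
      · exfalso; linarith
      · exfalso; linarith
      · exact m1.symm
    · rw [sandwiched_succ_iff, h0, l1]; decide
  · refine ⟨k + 1, isNextSandwiched_succ ?_, by omega, Or.inl ⟨h1, by linarith⟩⟩
    rw [sandwiched_succ_iff, h0, l1]
  · exfalso; linarith

theorem IsOrbit.next_of_B_B {a c : ℝ} (ha : 0 < a) (hac : a < c) {v : Word} {x : ℤ → ℝ}
    (h : IsOrbit a c v x) {k : ℤ} (h0 : v k = B) (h1 : v (k + 1) = B) :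
    ∃ m, IsNextSandwiched v k m ∧ m ≤ k + 3 ∧
      (v m = B ∧ x m = x k - (c - a) ∨ v m = C ∧ x m = x k - 2 * (c - a) ∨
        v m = A ∧ x m = x k + 4 * a - c) := by
  have P := h.cases ha.le hac.le
  have Q0 := P k
  have Q1 := P (k + 1)
  simp only [h0, h1, reduceCtorEq, false_and, false_or, or_false, true_and] at Q0 Q1
  obtain ⟨a1, a2, a3⟩ := Q0
  obtain ⟨b1, b2, b3⟩ := Q1
  rcases P (k + 1 + 1) with ⟨l1, l2, l3, l4⟩ | ⟨l1, l2, l3, l4⟩ | ⟨l1, l2, l3, l4⟩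
  · exfalso; linarith
  · refine ⟨k + 1, isNextSandwiched_succ ?_, by omega, Or.inl ⟨h1, by linarith⟩⟩
    rw [sandwiched_succ_iff, h0, l1]
  · obtain ⟨m, hm, hb, hx⟩ := h.next_of_B_C ha hac h1 l1
    refine ⟨m, hm.of_succ ?_, by omega, Or.inr ?_⟩
    · rw [sandwiched_succ_iff, h0, l1]; decide
    · rcases hx with ⟨e1, e2⟩ | ⟨e1, e2⟩
      · exact Or.inl ⟨e1, by linarith⟩
      · exact Or.inr ⟨e1, by linarith⟩

theorem IsOrbit.next_of_C_B {a c : ℝ} (ha : 0 < a) (hac : a < c) {v : Word} {x : ℤ → ℝ}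
    (h : IsOrbit a c v x) {k : ℤ} (h0 : v k = C) (h1 : v (k + 1) = B) :
    ∃ m, IsNextSandwiched v k m ∧ m ≤ k + 4 ∧
      (v m = B ∧ x m = x k + 2 * a + c ∨ v m = B ∧ x m = x k + 3 * a ∨
        v m = C ∧ x m = x k + 4 * a - c ∨ v m = A ∧ x m = x k + 6 * a) := by
  have P := h.cases ha.le hac.le
  have Q0 := P k
  have Q1 := P (k + 1)
  simp only [h0, h1, reduceCtorEq, false_and, false_or, or_false, true_and] at Q0 Q1
  obtain ⟨a1, a2, a3⟩ := Q0
  obtain ⟨b1, b2, b3⟩ := Q1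
  rcases P (k + 1 + 1) with ⟨l1, l2, l3, l4⟩ | ⟨l1, l2, l3, l4⟩ | ⟨l1, l2, l3, l4⟩
  · exfalso; linarith
  · obtain ⟨m, hm, hb, hx⟩ := h.next_of_B_B ha hac h1 l1
    refine ⟨m, hm.of_succ ?_, by omega, Or.inr ?_⟩
    · rw [sandwiched_succ_iff, h0, l1]; decide
    · rcases hx with ⟨e1, e2⟩ | ⟨e1, e2⟩ | ⟨e1, e2⟩
      · exact Or.inl ⟨e1, by linarith⟩
      · exact Or.inr (Or.inl ⟨e1, by linarith⟩)
      · exact Or.inr (Or.inr ⟨e1, by linarith⟩)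
  · refine ⟨k + 1, isNextSandwiched_succ ?_, by omega, Or.inl ⟨h1, by linarith⟩⟩
    rw [sandwiched_succ_iff, h0, l1]

/-- The first sandwiched place after an arbitrary place of an orbit. -/
theorem IsOrbit.exists_next {a c : ℝ} (ha : 0 < a) (hac : a < c) {v : Word} {x : ℤ → ℝ}
    (h : IsOrbit a c v x) (k : ℤ) :
    ∃ m, IsNextSandwiched v k m ∧ m ≤ k + 5 ∧
      (v k = A ∧ (v m = C ∧ x m = x k - (a + 2 * c) ∨ v m = B ∧ x m = x k + a - c ∨
          v m = B ∧ x m = x k + 2 * a - 2 * c ∨ v m = C ∧ x m = x k + 3 * a - 3 * c ∨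
          v m = A ∧ x m = x k + 5 * a - 2 * c) ∨
        v k = B ∧ (v m = C ∧ x m = x k - (c - a) ∨ v m = A ∧ x m = x k + 3 * a ∨
          v m = B ∧ x m = x k - (c - a) ∨ v m = C ∧ x m = x k - 2 * (c - a) ∨
          v m = A ∧ x m = x k + 4 * a - c) ∨
        v k = C ∧ (v m = A ∧ x m = x k + 2 * a + c ∨ v m = B ∧ x m = x k + 2 * a + c ∨
          v m = B ∧ x m = x k + 3 * a ∨ v m = C ∧ x m = x k + 4 * a - c ∨
          v m = A ∧ x m = x k + 6 * a)) := by
  have P := h.cases ha.le hac.le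
  rcases P k with ⟨h0, a1, a2, a3⟩ | ⟨h0, a1, a2, a3⟩ | ⟨h0, a1, a2, a3⟩ <;>
  rcases P (k + 1) with ⟨h1, b1, b2, b3⟩ | ⟨h1, b1, b2, b3⟩ | ⟨h1, b1, b2, b3⟩ <;>
  simp only [h0, reduceCtorEq, false_and, false_or, or_false, true_and]
  · exfalso; linarith
  · exfalso; linarith
  · rcases P (k + 1 + 1) with ⟨l1, l2, l3, l4⟩ | ⟨l1, l2, l3, l4⟩ | ⟨l1, l2, l3, l4⟩
    · refine ⟨k + 1, isNextSandwiched_succ ?_, by omega, Or.inl ⟨h1, a3⟩⟩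
      rw [sandwiched_succ_iff, h0, l1]
    · obtain ⟨m, hm, hb, hx⟩ := h.next_of_C_B ha hac h1 l1
      refine ⟨m, hm.of_succ ?_, by omega, Or.inr ?_⟩
      · rw [sandwiched_succ_iff, h0, l1]; decide
      · rcases hx with ⟨e1, e2⟩ | ⟨e1, e2⟩ | ⟨e1, e2⟩ | ⟨e1, e2⟩
        · exact Or.inl ⟨e1, by linarith⟩
        · exact Or.inr (Or.inl ⟨e1, by linarith⟩)
        · exact Or.inr (Or.inr (Or.inl ⟨e1, by linarith⟩))
        · exact Or.inr (Or.inr (Or.inr ⟨e1, by linarith⟩))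
    · exfalso; linarith
  · exfalso; linarith
  · obtain ⟨m, hm, hb, hx⟩ := h.next_of_B_B ha hac h0 h1
    exact ⟨m, hm, by omega, Or.inr (Or.inr hx)⟩
  · obtain ⟨m, hm, hb, hx⟩ := h.next_of_B_C ha hac h0 h1
    exact ⟨m, hm, by omega, by tauto⟩
  · refine ⟨k + 1, isNextSandwiched_succ ?_, by omega, Or.inl ⟨h1, by linarith⟩⟩
    rw [sandwiched_succ_iff, h0]
    rcases P (k + 1 + 1) with ⟨l1, l2, l3, l4⟩ | ⟨l1, l2, l3, l4⟩ | ⟨l1, l2, l3, l4⟩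
    · exfalso; linarith
    · exfalso; linarith
    · exact l1.symm
  · obtain ⟨m, hm, hb, hx⟩ := h.next_of_C_B ha hac h0 h1
    exact ⟨m, hm, by omega, Or.inr hx⟩
  · exfalso; linarith

/-- The sandwiched letters of an orbit occur in the order prescribed by the derived direction. -/
theorem IsOrbit.derived_step {a c : ℝ} (ha : 0 < a) (hac : a < c) (h2 : c ≠ 2 * a)
    (h3 : c ≠ 3 * a) {v : Word} {x : ℤ → ℝ} (h : IsOrbit a c v x) {n : ℤ} (hn : Sandwiched v n) :
    ∃ m, IsNextSandwiched v n m ∧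
      -x m + derivedOffset a c (v m) =
        -x n + derivedOffset a c (v n) - shift a (2 * a - c) (v n) := by
  obtain ⟨m, hm, -, hx⟩ := h.exists_next ha hac n
  refine ⟨m, hm, ?_⟩
  have bn := h.sandwiched_bounds ha hac hn
  have bm := h.sandwiched_bounds ha hac hm.2.1
  obtain ⟨e1, o1, hreg⟩ := derived_values ha hac h2 h3
  -- Every possible displacement is tested in every regime: either the identity is linear
  -- arithmetic, or the bounds at `n` and `m` show that this displacement does not occur there.
  rcases hx with ⟨k, hx⟩ | ⟨k, hx⟩ | ⟨k, hx⟩ <;>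
  rcases hx with ⟨l, hx⟩ | ⟨l, hx⟩ | ⟨l, hx⟩ | ⟨l, hx⟩ | ⟨l, hx⟩ <;>
  simp only [k, l, reduceCtorEq, false_and, false_or, or_false, true_and] at bn bm ⊢ <;>
  rcases hreg with ⟨r, e2, e3, o2, o3⟩ | ⟨⟨r, r'⟩, e2, e3, o2, o3⟩ | ⟨r, e2, e3, o2, o3⟩ <;>
  simp only [e1, e2, e3, o1, o2, o3] <;> clear e1 e2 e3 o1 o2 o3 <;>
  first
  | linarith
  | (exfalso
     first
     | (rcases bn with ⟨bn, bn'⟩ | ⟨bn, bn'⟩ <;> linarith)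
     | (rcases bm with ⟨bm, bm'⟩ | ⟨bm, bm'⟩ <;> linarith)
     | (rcases bn with ⟨bn, bn'⟩ | ⟨bn, bn'⟩ <;>
        rcases bm with ⟨bm, bm'⟩ | ⟨bm, bm'⟩ <;> linarith))

/-! ### Enumeration of the sandwiched places -/

/-- A set of integers unbounded in both directions is a locally finite order without end points,
hence order isomorphic to `ℤ`. -/
theorem exists_strictMono_range_eq {S : Set ℤ} (hup : ∀ k, ∃ m ∈ S, k < m)
    (hdown : ∀ k, ∃ m ∈ S, m < k) : ∃ f : ℤ → ℤ, StrictMono f ∧ Set.range f = S := by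
  classical
  have : NoMaxOrder S := ⟨fun k => (hup k).elim fun m hm => ⟨⟨m, hm.1⟩, hm.2⟩⟩
  have : NoMinOrder S := ⟨fun k => (hdown k).elim fun m hm => ⟨⟨m, hm.1⟩, hm.2⟩⟩
  have : Nonempty S := (hup 0).elim fun m hm => ⟨⟨m, hm.1⟩⟩
  let : SuccOrder S := LinearLocallyFiniteOrder.succOrder S
  let : PredOrder S := LinearLocallyFiniteOrder.predOrder S
  let e : S ≃o ℤ := orderIsoIntOfLinearSuccPredArch
  refine ⟨fun n => (e.symm n : ℤ), fun a b h => e.symm.strictMono h, ?_⟩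
  ext m
  constructor
  · rintro ⟨n, rfl⟩
    exact (e.symm n).2
  · intro hm
    exact ⟨e ⟨m, hm⟩, by simp⟩

theorem IsNextSandwiched.eq_apply_succ {v : Word} {f : ℤ → ℤ} (hf : StrictMono f)
    (hr : Set.range f = {n | Sandwiched v n}) {k m : ℤ} (h : IsNextSandwiched v (f k) m) :
    m = f (k + 1) := by
  obtain ⟨l, rfl⟩ : m ∈ Set.range f := hr ▸ h.2.1
  have h1 : k < l := hf.lt_iff_lt.1 h.1
  by_contra hne
  have h2 : k + 1 < l := lt_of_le_of_ne h1 (fun e => hne (by rw [e]))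
  have h3 : f (k + 1) ∈ {n | Sandwiched v n} := hr ▸ Set.mem_range_self _
  exact h.2.2 _ (hf (lt_add_one k)) (hf h2) h3

theorem IsOrbit.exists_isDerived {a c : ℝ} (ha : 0 < a) (hac : a < c) {v : Word} {x : ℤ → ℝ}
    (h : IsOrbit a c v x) : ∃ v', IsDerived v v' := by
  obtain ⟨f, hf, hr⟩ := exists_strictMono_range_eq (S := {n | Sandwiched v n})
    (fun k => by
      obtain ⟨m, hm, -⟩ := h.exists_next ha hac k
      exact ⟨m, hm.2.1, hm.1⟩)
    (fun k => by
      -- The next sandwiched place is at distance at most `5`, so starting from `k - 6` it is still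
      -- before `k`.
      obtain ⟨m, hm, hb, -⟩ := h.exists_next ha hac (k - 6)
      exact ⟨m, hm.2.1, by omega⟩)
  exact ⟨fun n => v (f n), f, hf, hr, fun n => rfl⟩

/-- The derived word of an orbit codes an orbit of the flow in the direction that is the image of
the given one under the Veech element `gam`. -/
theorem IsOrbit.of_isDerived {a c : ℝ} (ha : 0 < a) (hac : a < c) (h2 : c ≠ 2 * a) (h3 : c ≠ 3 * a)
    {v : Word} {x : ℤ → ℝ} (h : IsOrbit a c v x) {v' : Word} (hv : IsDerived v v') :
    ∃ y, IsOrbit a (2 * a - c) v' y := by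
  obtain ⟨f, hf, hr, hw⟩ := hv
  have hS : ∀ n, Sandwiched v (f n) := fun n => by
    have : f n ∈ {n | Sandwiched v n} := hr ▸ Set.mem_range_self n
    exact this
  refine ⟨fun n => -x (f n) + derivedOffset a c (v (f n)), fun n => ?_, fun n => ?_⟩
  · rw [hw]
    exact h.derived_mem ha hac h2 h3 (hS n)
  · obtain ⟨m, hm, e⟩ := h.derived_step ha hac h2 h3 (hS n)
    rw [hw, ← hm.eq_apply_succ hf hr, e]

/-! ### Rational independence -/

/-- The coordinates of `v` are linearly independent over the rationals. -/
def Irr (v : ℝ × ℝ) : Prop := ∀ m n : ℤ, m * v.1 + n * v.2 = 0 → m = 0 ∧ n = 0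

theorem Irr.smul {v : ℝ × ℝ} (h : Irr v) {r : ℝ} (hr : r ≠ 0) : Irr (r * v.1, r * v.2) := by
  intro m n e
  apply h
  have : r * (m * v.1 + n * v.2) = 0 := by linear_combination e
  exact (mul_eq_zero.1 this).resolve_left hr

theorem Irr.iso {v : ℝ × ℝ} (h : Irr v) (i : Fin 6) : Irr (iso i v) := by
  intro m n e
  fin_cases i
  · exact h m n e
  · change (m : ℝ) * v.2 + n * v.1 = 0 at e
    have := h n m (by linear_combination e)
    omega
  · change (m : ℝ) * -v.2 + n * (v.1 + v.2) = 0 at e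
    have := h n (n - m) (by push_cast; linear_combination e)
    omega
  · change (m : ℝ) * (v.1 + v.2) + n * -v.2 = 0 at e
    have := h m (m - n) (by push_cast; linear_combination e)
    omega
  · change (m : ℝ) * -(v.1 + v.2) + n * v.1 = 0 at e
    have := h (n - m) (-m) (by push_cast; linear_combination e)
    omega
  · change (m : ℝ) * v.1 + n * -(v.1 + v.2) = 0 at e
    have := h (m - n) (-n) (by push_cast; linear_combination e)
    omega

theorem Irr.ne_zero {v : ℝ × ℝ} (h : Irr v) {m n : ℤ} (hmn : m ≠ 0 ∨ n ≠ 0) :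
    m * v.1 + n * v.2 ≠ 0 := fun e => by
  have := h m n e
  omega

theorem IsOrbit.eq_of_eq {a c : ℝ} (ha : 0 ≤ a) (hac : a ≤ c) {v : Word} {x : ℤ → ℝ}
    (h : IsOrbit a c v x) {m n : ℤ} (e : x m = x n) : v m = v n := by
  rcases h.cases ha hac m with ⟨h1, h2, h3, h4⟩ | ⟨h1, h2, h3, h4⟩ | ⟨h1, h2, h3, h4⟩ <;>
  rcases h.cases ha hac n with ⟨k1, k2, k3, -⟩ | ⟨k1, k2, k3, -⟩ | ⟨k1, k2, k3, -⟩ <;>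
  first
  | (rw [h1, k1]; done)
  | (exfalso; linarith)

theorem IsOrbit.prev_eq_of_eq {a c : ℝ} (ha : 0 ≤ a) (hac : a ≤ c) {v : Word} {x : ℤ → ℝ}
    (h : IsOrbit a c v x) {m n : ℤ} (e : x m = x n) : v (m - 1) = v (n - 1) := by
  rcases h.cases_prev ha hac m with ⟨h1, h2, h3⟩ | ⟨h1, h2, h3⟩ | ⟨h1, h2, h3⟩ <;>
  rcases h.cases_prev ha hac n with ⟨k1, k2, k3⟩ | ⟨k1, k2, k3⟩ | ⟨k1, k2, k3⟩ <;>
  first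
  | (rw [h1, k1]; done)
  | (exfalso; linarith)

theorem IsOrbit.bounds {a c : ℝ} (ha : 0 ≤ a) (hac : a ≤ c) {v : Word} {x : ℤ → ℝ}
    (h : IsOrbit a c v x) (n : ℤ) : |x n| < a + c := by
  rw [abs_lt]
  rcases h.cases ha hac n with ⟨h1, h2, h3, h4⟩ | ⟨h1, h2, h3, h4⟩ | ⟨h1, h2, h3, h4⟩ <;>
  constructor <;> linarith

/-- A point of the orbit determines both the letter at its place and the letter before it, so
equality of two points propagates forwards and backwards. -/
theorem IsOrbit.isPeriodic_of_eq {a c : ℝ} (ha : 0 ≤ a) (hac : a ≤ c) {v : Word} {x : ℤ → ℝ}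
    (h : IsOrbit a c v x) {m n : ℤ} (hmn : m ≠ n) (e : x m = x n) : IsPeriodic v := by
  refine ⟨m - n, sub_ne_zero.2 hmn, ?_⟩
  have hx : ∀ k : ℤ, x (k + (m - n)) = x k := by
    intro k
    induction k using Int.inductionOn' (b := n) with
    | zero => rw [add_sub_cancel]; exact e
    | succ k _ ih =>
      rw [show k + 1 + (m - n) = k + (m - n) + 1 by ring, h.step, h.step, ih, h.eq_of_eq ha hac ih]
    | pred k _ ih =>
      have h1 := h.step (k + (m - n) - 1)
      have h2 := h.step (k - 1)
      rw [sub_add_cancel] at h1 h2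
      rw [h.prev_eq_of_eq ha hac ih] at h1
      rw [show k - 1 + (m - n) = k + (m - n) - 1 by ring]
      linarith
  exact fun k => h.eq_of_eq ha hac (hx k)

/-- A rational relation makes `a` and `c` integer multiples of some `δ`. The orbit then lies in a
bounded part of a translate of `δℤ`, and the pigeonhole principle gives a repeated point. -/
theorem IsOrbit.irr_of_not_isPeriodic {a c : ℝ} (ha : 0 ≤ a) (hac : a ≤ c) {v : Word} {x : ℤ → ℝ}
    (h : IsOrbit a c v x) (hv : ¬ IsPeriodic v) : Irr (a, c) := by
  intro m n hmn
  simp only at hmn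
  by_contra h0
  have hc : 0 < a + c := lt_of_le_of_lt (abs_nonneg _) (h.bounds ha hac 0)
  obtain ⟨δ, P, Q, hP, hQ⟩ : ∃ (δ : ℝ) (P Q : ℤ), a = P * δ ∧ c = Q * δ := by
    by_cases hm : m = 0
    · have hn : (n : ℝ) ≠ 0 := by
        have : n ≠ 0 := fun hn => h0 ⟨hm, hn⟩
        exact_mod_cast this
      refine ⟨a / n, n, -m, by field_simp, ?_⟩
      push_cast
      field_simp
      linarith
    · have hm : (m : ℝ) ≠ 0 := by exact_mod_cast hm
      refine ⟨c / m, -n, m, ?_, by field_simp⟩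
      push_cast
      field_simp
      linarith
  have hδ : δ ≠ 0 := by
    rintro rfl
    simp only [mul_zero] at hP hQ
    linarith
  have hz : ∀ k : ℤ, ∃ z : ℤ, x k = x 0 + δ * z := by
    have hs : ∀ L, ∃ z : ℤ, shift a c L = δ * z := by
      have ht : ∀ L, ∃ z : ℤ, twist a c L = δ * z := by
        intro L
        cases L
        · exact ⟨P + 2 * Q, by simp only [twist]; push_cast; rw [hP, hQ]; ring⟩
        · exact ⟨Q - P, by simp only [twist]; push_cast; rw [hP, hQ]; ring⟩
        · exact ⟨-(2 * P + Q), by simp only [twist]; push_cast; rw [hP, hQ]; ring⟩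
      intro L
      obtain ⟨z, hz⟩ := ht L
      unfold shift
      split_ifs
      · exact ⟨z, hz⟩
      · exact ⟨-z, by rw [hz]; push_cast; ring⟩
    intro k
    induction k using Int.induction_on with
    | zero => exact ⟨0, by simp⟩
    | succ k ih =>
      obtain ⟨z, hz⟩ := ih
      obtain ⟨s, hs⟩ := hs (v k)
      exact ⟨z - s, by rw [h.step, hz, hs]; push_cast; ring⟩
    | pred k ih =>
      obtain ⟨z, hz⟩ := ih
      obtain ⟨s, hs⟩ := hs (v (-k - 1))
      have := h.step (-k - 1)
      rw [sub_add_cancel] at this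
      exact ⟨z + s, by push_cast; linarith⟩
  choose z hz using hz
  obtain ⟨K, hK⟩ := exists_nat_gt (2 * (a + c) / |δ|)
  have hzK : ∀ k, z k ∈ Set.Icc (-(K : ℤ)) K := by
    intro k
    have h1 : |δ| * |(z k : ℝ)| < 2 * (a + c) := by
      rw [← abs_mul, show δ * z k = x k - x 0 by rw [hz k]; ring]
      have := abs_sub (x k) (x 0)
      linarith [h.bounds ha hac k, h.bounds ha hac 0]
    have h2 : |(z k : ℝ)| < K := by
      refine lt_trans ?_ hK
      rw [lt_div_iff₀ (abs_pos.2 hδ)]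
      linarith
    have h3 : |z k| < (K : ℤ) := by exact_mod_cast h2
    rw [abs_lt] at h3
    exact ⟨h3.1.le, h3.2.le⟩
  obtain ⟨k, l, hkl, e⟩ := Finite.exists_ne_map_eq_of_infinite
    (fun k : ℤ => (⟨z k, hzK k⟩ : Set.Icc (-(K : ℤ)) K))
  have e : z k = z l := congrArg Subtype.val e
  exact hv (h.isPeriodic_of_eq ha hac hkl (by rw [hz k, hz l, e]))

/-! ### Transitions that occur in orbits -/

/-- Without `B B`, every second letter is `C`. Passing from one letter other than `C` to the next is
then a rotation by `3 * a` on a circle of length `c + 2 * a`. By independence its orbits are dense,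
but they would have to avoid the points of `B` with successor in `B`. -/
theorem IsOrbit.exists_B_B {a c : ℝ} (ha : 0 < a) (hac : a < c) (hi : Irr (a, c)) {v : Word}
    {x : ℤ → ℝ} (h : IsOrbit a c v x) : ∃ n, v n = B ∧ v (n + 1) = B := by
  by_contra hno
  push Not at hno
  have P := h.cases ha.le hac.le
  -- The gap between `c - 2 * a` and `c` is the interval that the rotation will be shown to hit.
  have range : ∀ n, v n ≠ C → -a < x n ∧ x n < a + c ∧ (x n < c - 2 * a ∨ c < x n) := by
    intro n hn
    rcases P n with ⟨h1, h2, h3, h4⟩ | ⟨h1, h2, h3, h4⟩ | ⟨h1, -⟩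
    · exact ⟨by linarith, h3, Or.inr h2⟩
    · refine ⟨h2, by linarith, Or.inl ?_⟩
      rcases P (n + 1) with ⟨k1, k2, k3, -⟩ | ⟨k1, -⟩ | ⟨k1, k2, k3, -⟩
      · exfalso; linarith
      · exact absurd k1 (hno n h1)
      · linarith
    · exact absurd h1 hn
  have forward : ∀ n, v n ≠ C → v (n + 1) = C ∧ v (n + 1 + 1) ≠ C ∧
      ∃ j : ℤ, x (n + 1 + 1) = x n + 3 * a + j * (c + 2 * a) := by
    intro n hn
    have r := range n hn
    rcases P n with ⟨h1, h2, h3, h4⟩ | ⟨h1, h2, h3, h4⟩ | ⟨h1, -⟩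
    · rcases P (n + 1) with ⟨k1, k2, k3, k4⟩ | ⟨k1, k2, k3, k4⟩ | ⟨k1, k2, k3, k4⟩
      · exfalso; linarith
      · exfalso; linarith
      · refine ⟨k1, fun hC => ?_, -1, by push_cast; linarith⟩
        rcases P (n + 1 + 1) with ⟨l1, -⟩ | ⟨l1, -⟩ | ⟨l1, l2, l3, -⟩
        · rw [l1] at hC; cases hC
        · rw [l1] at hC; cases hC
        · linarith
    · rcases P (n + 1) with ⟨k1, k2, k3, k4⟩ | ⟨k1, k2, k3, k4⟩ | ⟨k1, k2, k3, k4⟩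
      · exfalso; linarith
      · exact absurd k1 (hno n h1)
      · refine ⟨k1, fun hC => ?_, 0, by push_cast; linarith⟩
        rcases P (n + 1 + 1) with ⟨l1, -⟩ | ⟨l1, -⟩ | ⟨l1, l2, l3, -⟩
        · rw [l1] at hC; cases hC
        · rw [l1] at hC; cases hC
        · linarith
    · exact absurd h1 hn
  have ofC : ∀ n, v n = C → v (n + 1) ≠ C := by
    intro n hn hC
    rcases P n with ⟨h1, -⟩ | ⟨h1, -⟩ | ⟨-, h2, h3, h4⟩
    · rw [h1] at hn; cases hn
    · rw [h1] at hn; cases hn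
    · rcases P (n + 1) with ⟨l1, -⟩ | ⟨l1, -⟩ | ⟨l1, l2, l3, -⟩
      · rw [l1] at hC; cases hC
      · rw [l1] at hC; cases hC
      · linarith
  have backward : ∀ n, v n ≠ C → v (n - 1 - 1) ≠ C := by
    intro n hn hC
    have h1 := ofC _ hC
    rw [sub_add_cancel] at h1
    have h2 := (forward _ h1).1
    rw [sub_add_cancel] at h2
    exact hn h2
  obtain ⟨n, hn⟩ : ∃ n, v n ≠ C := by
    by_cases h0 : v 0 = C
    · exact ⟨_, ofC 0 h0⟩
    · exact ⟨0, h0⟩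
  have rot : ∀ k : ℤ, v (n + 2 * k) ≠ C ∧
      ∃ j : ℤ, x (n + 2 * k) = x n + k * (3 * a) + j * (c + 2 * a) := by
    intro k
    induction k using Int.induction_on with
    | zero => exact ⟨by simpa using hn, 0, by simp⟩
    | succ k ih =>
      obtain ⟨h1, j, hj⟩ := ih
      obtain ⟨-, h2, j', hj'⟩ := forward _ h1
      rw [show n + 2 * ((k : ℤ) + 1) = n + 2 * k + 1 + 1 by ring]
      refine ⟨h2, j + j', ?_⟩
      rw [hj', hj]; push_cast; ring
    | pred k ih =>
      obtain ⟨h1, j, hj⟩ := ih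
      have h2 := backward _ h1
      obtain ⟨-, -, j', hj'⟩ := forward _ h2
      rw [sub_add_cancel, sub_add_cancel] at hj'
      rw [show n + 2 * (-(k : ℤ) - 1) = n + 2 * (-k) - 1 - 1 by ring]
      refine ⟨h2, j - j', ?_⟩
      push_cast at hj ⊢
      linarith
  have hirr : Irrational (3 * a / (c + 2 * a)) := by
    rintro ⟨r, hr⟩
    have hd : (r.den : ℝ) ≠ 0 := by exact_mod_cast r.den_ne_zero
    have hca : c + 2 * a ≠ 0 := by linarith
    have hr' : (r.num : ℝ) / r.den = 3 * a / (c + 2 * a) := by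
      rw [← hr]; exact (Rat.cast_def r).symm
    rw [div_eq_div_iff hd hca] at hr'
    have := hi (2 * r.num - 3 * r.den) r.num (by push_cast; linear_combination hr')
    have hden := r.den_pos
    omega
  have hdense := dense_addSubgroupClosure_pair_iff.2 hirr
  obtain ⟨s, hs, hsmem⟩ := hdense.exists_mem_open (isOpen_Ioo (a := c - 2 * a - x n)
    (b := c - x n)) (Set.nonempty_Ioo.2 (by linarith))
  rw [SetLike.mem_coe, AddSubgroup.mem_closure_pair] at hs
  obtain ⟨k, l, hkl⟩ := hs
  simp only [zsmul_eq_mul] at hkl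
  obtain ⟨h1, j, hj⟩ := rot k
  obtain ⟨r1, r2, r3⟩ := range _ h1
  have e : x (n + 2 * k) = x n + s + (j - l) * (c + 2 * a) := by rw [hj, ← hkl]; ring
  -- Both `x (n + 2 * k)` and `x n + s` lie in the fundamental interval from `-a` to `a + c`, so
  -- being congruent they coincide.
  have hlt : |((j - l : ℤ) : ℝ)| < 1 := by
    have hpos : 0 < c + 2 * a := by linarith
    have : |((j - l : ℤ) : ℝ)| * (c + 2 * a) < 1 * (c + 2 * a) := by
      rw [← abs_of_pos hpos, ← abs_mul, abs_of_pos hpos, abs_lt]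
      push_cast
      constructor <;> linarith [hsmem.1, hsmem.2]
    exact lt_of_mul_lt_mul_right this hpos.le
  have hjl : j - l = 0 := Int.abs_lt_one_iff.1 (by exact_mod_cast hlt)
  have hjl' : (j : ℝ) - l = 0 := by exact_mod_cast hjl
  rw [hjl', zero_mul, add_zero] at e
  rcases r3 with r3 | r3 <;> linarith [hsmem.1, hsmem.2]

/-- Each `B` lowers the coordinate by `c - a > 0`, so a run of `B` must end because the orbit is
bounded; it cannot end in `A`, which lies too high. -/
theorem IsOrbit.exists_B_C {a c : ℝ} (ha : 0 < a) (hac : a < c) {v : Word} {x : ℤ → ℝ}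
    (h : IsOrbit a c v x) {n : ℤ} (hn : v n = B) : ∃ n, v n = B ∧ v (n + 1) = C := by
  by_contra hno
  push Not at hno
  have P := h.cases ha.le hac.le
  have key : ∀ k : ℕ, v (n + k) = B ∧ x (n + k) = x n - k * (c - a) := by
    intro k
    induction k with
    | zero => simp [hn]
    | succ k ih =>
      obtain ⟨h1, h2⟩ := ih
      have Q := P (n + k)
      simp only [h1, reduceCtorEq, false_and, false_or, or_false, true_and] at Q
      have e : n + ((k + 1 : ℕ) : ℤ) = n + k + 1 := by push_cast; ring
      rw [e]
      refine ⟨?_, by rw [Q.2.2, h2]; push_cast; ring⟩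
      rcases P (n + k + 1) with ⟨k1, k2, k3, -⟩ | ⟨k1, -⟩ | ⟨k1, k2, k3, -⟩
      · exfalso; linarith
      · exact k1
      · exact absurd k1 (hno _ h1)
  obtain ⟨k, hk⟩ := exists_nat_gt (2 * (a + c) / (c - a))
  rw [div_lt_iff₀ (by linarith)] at hk
  have h1 := (abs_lt.1 (h.bounds ha.le hac.le (n + k))).1
  have h2 := (abs_lt.1 (h.bounds ha.le hac.le n)).2
  rw [(key k).2] at h1
  linarith

/-- In the normal form both `B B` and `B C` occur. The first forces the vertex with the loop, the
second its neighbour, and together these determine the diagram. -/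
theorem IsOrbit.admissible_iff {i : Fin 6} {a c : ℝ} (ha : 0 < a) (hac : a < c) (hi : Irr (a, c))
    {w : Word} {x : ℤ → ℝ} (h : IsOrbit a c (HexCut.relabel i w) x) (j : Fin 6) :
    Admissible j w ↔ j = i := by
  have hB : ∀ (i : Fin 6) (L : Letter), labelPerm i L = B → L = (diagram i).2.2 := by
    intro i L; fin_cases i <;> cases L <;> decide
  have hC : ∀ (i : Fin 6) (L : Letter), labelPerm i L = C → L = (diagram i).2.1 := by
    intro i L; fin_cases i <;> cases L <;> decide
  have comb : ∀ i j : Fin 6, Arrow j (diagram i).2.2 (diagram i).2.2 →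
      Arrow j (diagram i).2.2 (diagram i).2.1 → j = i := by
    unfold Arrow; decide
  constructor
  · intro hj
    obtain ⟨n, h1, h2⟩ := h.exists_B_B ha hac hi
    obtain ⟨m, h3, h4⟩ := h.exists_B_C ha hac h1
    have h5 := hj n
    have h6 := hj m
    rw [hB i _ h1, hB i _ h2] at h5
    rw [hB i _ h3, hC i _ h4] at h6
    exact comb i j h5 h6
  · rintro rfl
    exact (admissible_iff_relabel j w).2 (h.admissible ha.le hac.le)

/-! ### Trajectories and orbits on a transversal -/

/-- The scalar products of `u` with the normals of the sides `A` and `C`. -/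
def coord (u : ℝ × ℝ) : ℝ × ℝ := (u.2, √3 / 2 * u.1 - u.2 / 2)

/-- The determinant of two vectors. -/
def cross (u p : ℝ × ℝ) : ℝ := u.1 * p.2 - u.2 * p.1

theorem sqrt_three_sq : √3 ^ 2 = 3 := Real.sq_sqrt (by norm_num)

theorem sqrt_three_pos : 0 < √3 := Real.sqrt_pos.2 (by norm_num)

theorem nrm_coord (u : ℝ × ℝ) (L : Letter) : nrm (coord u).1 (coord u).2 L = height L u := by
  cases L <;> simp only [nrm, coord, height, normal] <;> ring

theorem twist_coord (u : ℝ × ℝ) (L : Letter) :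
    twist (coord u).1 (coord u).2 L = √3 * cross u (normal L) := by
  cases L <;> simp only [twist, coord, cross, normal]
  · ring
  · linear_combination (u.2 / 2) * sqrt_three_sq
  · linear_combination (u.2 / 2) * sqrt_three_sq

theorem normal_unit (L : Letter) : (normal L).1 ^ 2 + (normal L).2 ^ 2 = 1 := by
  cases L <;> simp only [normal]
  · norm_num
  · linear_combination (1 / 4) * sqrt_three_sq
  · linear_combination (1 / 4) * sqrt_three_sq

theorem unit_cast_eq (ε : ℤˣ) : ((ε : ℤ) : ℝ) = 1 ∨ ((ε : ℤ) : ℝ) = -1 := by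
  rcases Int.units_eq_one_or ε with rfl | rfl <;> simp

theorem unit_cast_sq (ε : ℤˣ) : ((ε : ℤ) : ℝ) ^ 2 = 1 := by
  rcases unit_cast_eq ε with h | h <;> rw [h] <;> norm_num

theorem height_add_smul (L : Letter) (p d : ℝ × ℝ) (t : ℝ) :
    height L (p + t • d) = height L p + t * height L d := by
  simp only [height, Prod.fst_add, Prod.snd_add, Prod.smul_fst, Prod.smul_snd, smul_eq_mul]; ring

theorem cross_add_smul (u p d : ℝ × ℝ) (t : ℝ) :
    cross u (p + t • d) = cross u p + t * cross u d := by
  simp only [cross, Prod.fst_add, Prod.snd_add, Prod.smul_fst, Prod.smul_snd, smul_eq_mul]; ring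

theorem glue_eq (L : Letter) (ε : ℤˣ) (p : ℝ × ℝ) :
    glue L ε p = p + (-(((ε : ℤ) : ℝ) * √3)) • normal L := by
  rw [glue, neg_smul, sub_eq_add_neg]

/-- On the line of a side `L`, with `t` the position `cross (normal L) p`, the two other heights are
up to sign `√3 / 2 * (s / 2 ± t)`. Both are small exactly when `t` is within `1 / 2` of the
midpoint. -/
theorem mem_openSide_iff (L : Letter) (ε : ℤˣ) (p : ℝ × ℝ) :
    p ∈ openSide L ε ↔
      height L p = ((ε : ℤ) : ℝ) * (√3 / 2) ∧ |cross (normal L) p| < 1 / 2 := by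
  have h3 := sqrt_three_sq
  have h0 := sqrt_three_pos
  have hs := unit_cast_eq ε
  simp only [openSide, Set.mem_ofPred_eq]
  generalize ((ε : ℤ) : ℝ) = s at hs ⊢
  refine and_congr_right fun h => ?_
  have small : ∀ y, |√3 / 2 * y| < √3 / 2 ↔ |y| < 1 := by
    intro y
    rw [abs_mul, abs_of_pos (by positivity : 0 < √3 / 2)]
    constructor <;> intro hy <;> nlinarith
  have core : ∀ t : ℝ, (|s / 2 - t| < 1 ∧ |s / 2 + t| < 1) ↔ |t| < 1 / 2 := by
    intro t
    rcases hs with rfl | rfl <;> simp only [abs_lt] <;>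
      exact ⟨fun h => ⟨by linarith [h.1.1, h.1.2, h.2.1, h.2.2], by linarith [h.1.1, h.1.2, h.2.1, h.2.2]⟩,
        fun h => ⟨⟨by linarith [h.1, h.2], by linarith [h.1, h.2]⟩,
          ⟨by linarith [h.1, h.2], by linarith [h.1, h.2]⟩⟩⟩
  rw [← core, ← small, ← small]
  cases L
  · have e1 : height B p = √3 / 2 * (s / 2 - cross (normal A) p) := by
      simp only [height, normal, cross] at h ⊢
      linear_combination (1 / 2) * h
    have e2 : height C p = -(√3 / 2 * (s / 2 + cross (normal A) p)) := by
      simp only [height, normal, cross] at h ⊢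
      linear_combination (-1 / 2) * h
    rw [← e1, ← abs_neg (√3 / 2 * (s / 2 + _)), ← e2]
    exact ⟨fun H => ⟨H B (by decide), H C (by decide)⟩, fun H M hM => by
      cases M
      · exact absurd rfl hM
      · exact H.1
      · exact H.2⟩
  · have e1 : height C p = √3 / 2 * (s / 2 - cross (normal B) p) := by
      simp only [height, normal, cross] at h ⊢
      linear_combination (1 / 2) * h + p.2 / 4 * h3
    have e2 : height A p = √3 / 2 * (s / 2 + cross (normal B) p) := by
      simp only [height, normal, cross] at h ⊢
      linear_combination (1 / 2) * h - p.2 / 4 * h3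
    rw [← e1, ← e2]
    exact ⟨fun H => ⟨H C (by decide), H A (by decide)⟩, fun H M hM => by
      cases M
      · exact H.2
      · exact absurd rfl hM
      · exact H.1⟩
  · have e1 : height A p = -(√3 / 2 * (s / 2 - cross (normal C) p)) := by
      simp only [height, normal, cross] at h ⊢
      linear_combination (-1 / 2) * h - p.2 / 4 * h3
    have e2 : height B p = √3 / 2 * (s / 2 + cross (normal C) p) := by
      simp only [height, normal, cross] at h ⊢
      linear_combination (1 / 2) * h - p.2 / 4 * h3
    rw [← abs_neg (√3 / 2 * (s / 2 - _)), ← e1, ← e2]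
    exact ⟨fun H => ⟨H A (by decide), H B (by decide)⟩, fun H M hM => by
      cases M
      · exact H.1
      · exact H.2
      · exact absurd rfl hM⟩

/-- The coordinate of a point along a transversal, from its coordinates relative to a side. -/
theorem cross_eq_normal (L : Letter) (u p : ℝ × ℝ) :
    cross u p = height L u * cross (normal L) p + cross u (normal L) * height L p := by
  simp only [cross, height]
  linear_combination (-(u.1 * p.2 - u.2 * p.1)) * normal_unit L

theorem shift_coord {u : ℝ × ℝ} {L : Letter} {ε : ℤˣ} (h : 0 < ((ε : ℤ) : ℝ) * height L u) :
    shift (coord u).1 (coord u).2 L = ((ε : ℤ) : ℝ) * (√3 * cross u (normal L)) := by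
  rcases unit_cast_eq ε with e | e <;> rw [e] at h ⊢
  · rw [shift_of_pos (by rw [nrm_coord]; linarith), twist_coord, one_mul]
  · rw [shift_of_neg (by rw [nrm_coord]; linarith), twist_coord]; ring

theorem LinearTrajectory.isOrbit (τ : LinearTrajectory) :
    IsOrbit (coord τ.dir).1 (coord τ.dir).2 τ.label (fun n => cross τ.dir (τ.exit n)) := by
  have hpos : ∀ n, 0 < ((τ.sign n : ℤ) : ℝ) * height (τ.label n) τ.dir := by
    intro n
    obtain ⟨t, ht, e⟩ := τ.straight n
    -- The midpoint of the chord is strictly inside the hexagon, so the direction points outwards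
    -- across the exit side.
    have hmid : τ.exit n + (-(t / 2)) • τ.dir ∈ openSegment ℝ (τ.entry n) (τ.exit n) := by
      refine ⟨1 / 2, 1 / 2, by norm_num, by norm_num, by norm_num, ?_⟩
      rw [e]
      ext <;> simp <;> ring
    have h1 := τ.chord_subset n hmid (τ.label n)
    rw [height_add_smul, (τ.exit_mem n).1, abs_lt] at h1
    rcases unit_cast_eq (τ.sign n) with e | e <;> rw [e] at h1 ⊢ <;> nlinarith
  refine ⟨fun n => ?_, fun n => ?_⟩
  · have h1 := (mem_openSide_iff _ _ _).1 (τ.exit_mem n)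
    rw [shift_coord (hpos n), nrm_coord, cross_eq_normal (τ.label n), h1.1,
      show ∀ N k c s : ℝ, N * k + c * (s * (√3 / 2)) - s * (√3 * c) / 2 = N * k by intros; ring,
      abs_mul]
    have : 0 < |height (τ.label n) τ.dir| := abs_pos.2 fun h0 => by
      have := hpos n
      rw [h0, mul_zero] at this
      exact lt_irrefl _ this
    nlinarith [h1.2]
  · obtain ⟨t, ht, e⟩ := τ.straight (n + 1)
    rw [shift_coord (hpos n), e, τ.entry_succ, cross_add_smul, glue_eq, cross_add_smul]
    have : cross τ.dir τ.dir = 0 := by simp only [cross]; ring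
    rw [this]; ring

theorem height_normal_self (L : Letter) : height L (normal L) = 1 := by
  rw [← normal_unit L, height]; ring

theorem cross_self (u : ℝ × ℝ) : cross u u = 0 := by simp only [cross]; ring

theorem mem_openSide_glue {L : Letter} {ε : ℤˣ} {p : ℝ × ℝ} (h : p ∈ openSide L ε) :
    glue L ε p ∈ openSide L (-ε) := by
  rw [mem_openSide_iff] at h ⊢
  rw [glue_eq, height_add_smul, cross_add_smul, height_normal_self, cross_self, mul_zero, add_zero]
  refine ⟨?_, h.2⟩
  rw [h.1]; push_cast; ring

/-- The coordinate `x n` fixes the exit point on the side chosen by the sign of `height (w n) u`.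
The step relation says that this point and the glued previous one have equal `cross u`, so they are
joined by a chord parallel to `u`. -/
theorem IsOrbit.exists_trajectory {u : ℝ × ℝ} (hu : u ≠ 0) {w : Word} {x : ℤ → ℝ}
    (h : IsOrbit (coord u).1 (coord u).2 w x) :
    ∃ τ : LinearTrajectory, τ.cuttingSequence = w ∧ τ.dir = u := by
  have hN : ∀ n, height (w n) u ≠ 0 := fun n => nrm_coord u (w n) ▸ h.nrm_ne_zero n
  have hs : ∀ n, ∃ ε : ℤˣ, 0 < ((ε : ℤ) : ℝ) * height (w n) u := by
    intro n
    rcases lt_or_gt_of_ne (hN n) with h1 | h1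
    · exact ⟨-1, by push_cast; linarith⟩
    · exact ⟨1, by push_cast; linarith⟩
  choose s hs using hs
  have hexit : ∀ n, ∃ p ∈ openSide (w n) (s n), cross u p = x n := by
    intro n
    obtain ⟨t, ht⟩ : ∃ t, t = (x n - (s n : ℤ) * (√3 * cross u (normal (w n))) / 2)
      / height (w n) u := ⟨_, rfl⟩
    rw [eq_div_iff (hN n)] at ht
    have h1 := h.mem n
    rw [shift_coord (hs n), ← ht, nrm_coord, abs_mul] at h1
    have hpos := abs_pos.2 (hN n)
    have h1 := (mem_openSide_iff (w n) (s n)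
      ((((s n : ℤ) : ℝ) * (√3 / 2)) • normal (w n) + t • (-(normal (w n)).2, (normal (w n)).1))).2
      ⟨by
        rw [height_add_smul]
        simp only [height, Prod.smul_fst, Prod.smul_snd, smul_eq_mul]
        linear_combination ((s n : ℤ) : ℝ) * (√3 / 2) * normal_unit (w n), by
        have : cross (normal (w n)) ((((s n : ℤ) : ℝ) * (√3 / 2)) • normal (w n) +
            t • (-(normal (w n)).2, (normal (w n)).1)) = t := by
          simp only [cross, Prod.fst_add, Prod.snd_add, Prod.smul_fst, Prod.smul_snd, smul_eq_mul]
          linear_combination t * normal_unit (w n)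
        rw [this]
        nlinarith⟩
    refine ⟨_, h1, ?_⟩
    have h2 := h1.1
    rw [cross_eq_normal (w n), h2]
    have : cross (normal (w n)) ((((s n : ℤ) : ℝ) * (√3 / 2)) • normal (w n) +
        t • (-(normal (w n)).2, (normal (w n)).1)) = t := by
      simp only [cross, Prod.fst_add, Prod.snd_add, Prod.smul_fst, Prod.smul_snd, smul_eq_mul]
      linear_combination t * normal_unit (w n)
    rw [this]
    linarith
  choose exit hexit hx using hexit
  have hentry : ∀ n, glue (w (n - 1)) (s (n - 1)) (exit (n - 1)) ∈
      openSide (w (n - 1)) (-s (n - 1)) := fun n => mem_openSide_glue (hexit _)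
  refine ⟨⟨u, hu, fun n => glue (w (n - 1)) (s (n - 1)) (exit (n - 1)), exit, w, s,
    fun n => ?_, fun n => ?_, hexit, fun n => by rw [add_sub_cancel_right]⟩, rfl, rfl⟩
  · have hc : cross u (exit n) = cross u (glue (w (n - 1)) (s (n - 1)) (exit (n - 1))) := by
      have := h.step (n - 1)
      rw [sub_add_cancel, shift_coord (hs _)] at this
      rw [glue_eq, cross_add_smul, hx, hx, this]; ring
    have he := hentry n
    generalize glue (w (n - 1)) (s (n - 1)) (exit (n - 1)) = p at hc he ⊢
    have huu : 0 < u.1 ^ 2 + u.2 ^ 2 := by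
      rcases eq_or_ne u.1 0 with h1 | h1
      · have : u.2 ≠ 0 := fun h2 => hu (Prod.ext h1 h2)
        positivity
      · positivity
    obtain ⟨t, ht⟩ : ∃ t, t = (u.1 * ((exit n).1 - p.1) + u.2 * ((exit n).2 - p.2))
      / (u.1 ^ 2 + u.2 ^ 2) := ⟨_, rfl⟩
    rw [eq_div_iff huu.ne'] at ht
    simp only [cross] at hc
    have e : exit n = p + t • u := by
      ext
      · have : (u.1 ^ 2 + u.2 ^ 2) * ((exit n).1 - (p.1 + t * u.1)) = 0 := by
          linear_combination (-u.1) * ht - u.2 * hc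
        have := (mul_eq_zero.1 this).resolve_left huu.ne'
        simp; linarith
      · have : (u.1 ^ 2 + u.2 ^ 2) * ((exit n).2 - (p.2 + t * u.2)) = 0 := by
          linear_combination (-u.2) * ht + u.1 * hc
        have := (mul_eq_zero.1 this).resolve_left huu.ne'
        simp; linarith
    refine ⟨t, ?_, e⟩
    have h1 : height (w (n - 1)) (exit n) = height (w (n - 1)) p + t * height (w (n - 1)) u := by
      rw [e, height_add_smul]
    have h2 := he.1
    push_cast at h2
    have h3 := hs (n - 1)
    -- Along the normal of the entry side the chord moves into the hexagon, which is also the sense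
    -- of `u`; comparing signs yields `0 < t`.
    have h4 : 0 < ((s (n - 1) : ℤ) : ℝ) * (height (w (n - 1)) (exit n) - height (w (n - 1)) p) := by
      have hu1 := unit_cast_sq (s (n - 1))
      have h0 := sqrt_three_pos
      rw [h2]
      by_cases hw : w (n - 1) = w n
      · have h5 : s (n - 1) = s n := by
          have k := hs n
          rw [← hw] at k
          rcases Int.units_eq_one_or (s (n - 1)) with a | a <;>
          rcases Int.units_eq_one_or (s n) with b | b <;> rw [a] at h3 ⊢ <;> rw [b] at k ⊢ <;>
          push_cast at h3 k <;> linarith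
        rw [hw, (hexit n).1, ← h5]
        nlinarith
      · have h5 := abs_lt.1 ((hexit n).2 _ hw)
        rcases unit_cast_eq (s (n - 1)) with a | a <;> rw [a] <;> linarith [h5.1, h5.2]
    rw [h1, show ∀ a b c d : ℝ, a * (b + c * d - b) = c * (a * d) by intros; ring] at h4
    exact (pos_iff_pos_of_mul_pos h4).2 h3
  · have he := hentry n
    generalize glue (w (n - 1)) (s (n - 1)) (exit (n - 1)) = p at he ⊢
    have hx' := hexit n
    have h0 := sqrt_three_pos
    rintro _ ⟨a, b, ha, hb, hab, rfl⟩ M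
    have e : height M (a • p + b • exit n) = a * height M p + b * height M (exit n) := by
      simp only [height, Prod.fst_add, Prod.snd_add, Prod.smul_fst, Prod.smul_snd, smul_eq_mul]
      ring
    have le : ∀ {L : Letter} {ε : ℤˣ} {q : ℝ × ℝ}, q ∈ openSide L ε → |height M q| ≤ √3 / 2 := by
      intro L ε q hq
      by_cases hM : M = L
      · rw [hM, hq.1]
        rcases unit_cast_eq ε with k | k <;> rw [k] <;> rw [abs_le] <;> constructor <;> linarith
      · exact (hq.2 M hM).le
    have l1 := abs_le.1 (le he)
    have l2 := abs_le.1 (le hx')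
    obtain rfl : b = 1 - a := by linarith
    rw [e, abs_lt]
    -- An end point off the sides `M` gives strict inequality. If both end points are on sides `M`,
    -- these sides are opposite.
    by_cases h1 : M = w n
    · by_cases h2 : M = w (n - 1)
      · have h5 : s (n - 1) = s n := by
          have k := hs n
          have k' := hs (n - 1)
          rw [← h1] at k
          rw [← h2] at k'
          rcases Int.units_eq_one_or (s (n - 1)) with a | a <;>
          rcases Int.units_eq_one_or (s n) with b | b <;> rw [a] at k' ⊢ <;> rw [b] at k ⊢ <;>
          push_cast at k' k <;> linarith
        have h6 := he.1
        have h7 := hx'.1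
        rw [← h2] at h6
        rw [← h1] at h7
        rw [h6, h7, h5]
        push_cast
        rcases unit_cast_eq (s n) with k | k <;> rw [k] <;> constructor <;> nlinarith
      · have := abs_lt.1 (he.2 M h2)
        constructor <;> nlinarith
    · have := abs_lt.1 (hx'.2 M h1)
      constructor <;> nlinarith

/-! ### Directions with the same itinerary -/

/-- The action of `gam * nu i` in the coordinates `(p, q)`. -/
def veech (i : Fin 6) (v : ℝ × ℝ) : ℝ × ℝ := ((iso i v).1, 2 * (iso i v).1 - (iso i v).2)

theorem cross_iso (i : Fin 6) (v v' : ℝ × ℝ) : |cross (iso i v) (iso i v')| = |cross v v'| := by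
  rw [abs_eq_abs]
  fin_cases i <;> simp [iso, cross]
  · exact Or.inl (by ring)
  · exact Or.inr (by ring)
  · exact Or.inl (by ring)
  · exact Or.inr (by ring)

theorem cross_veech (i : Fin 6) (v v' : ℝ × ℝ) :
    |cross (veech i v) (veech i v')| = |cross v v'| := by
  rw [← cross_iso i v v', ← abs_neg]
  congr 1
  simp only [veech, cross]
  ring

theorem iso_smul (i : Fin 6) (r : ℝ) (v : ℝ × ℝ) : iso i (r • v) = r • iso i v := by
  fin_cases i <;> ext <;> simp [iso] <;> ring

theorem veech_smul (i : Fin 6) (r : ℝ) (v : ℝ × ℝ) : veech i (r • v) = r • veech i v := by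
  ext <;> simp [veech, iso_smul]
  ring

theorem iso_veech (i j : Fin 6) (v : ℝ × ℝ) :
    iso j (veech i v) = ![((iso i v).1, 2 * (iso i v).1 - (iso i v).2),
      (2 * (iso i v).1 - (iso i v).2, (iso i v).1),
      ((iso i v).2 - 2 * (iso i v).1, 3 * (iso i v).1 - (iso i v).2),
      (3 * (iso i v).1 - (iso i v).2, (iso i v).2 - 2 * (iso i v).1),
      ((iso i v).2 - 3 * (iso i v).1, (iso i v).1),
      ((iso i v).1, (iso i v).2 - 3 * (iso i v).1)] j := by
  fin_cases j <;> ext <;> simp [veech, iso] <;> ring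

theorem iso_veech_cases (i j : Fin 6) (v : ℝ × ℝ) :
    ((iso j (veech i v)).1 = (iso i v).1 ∧
      (iso j (veech i v)).2 = 2 * (iso i v).1 - (iso i v).2) ∨
    ((iso j (veech i v)).1 = 2 * (iso i v).1 - (iso i v).2 ∧
      (iso j (veech i v)).2 = (iso i v).1) ∨
    ((iso j (veech i v)).1 = (iso i v).2 - 2 * (iso i v).1 ∧
      (iso j (veech i v)).2 = 3 * (iso i v).1 - (iso i v).2) ∨
    ((iso j (veech i v)).1 = 3 * (iso i v).1 - (iso i v).2 ∧
      (iso j (veech i v)).2 = (iso i v).2 - 2 * (iso i v).1) ∨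
    ((iso j (veech i v)).1 = (iso i v).2 - 3 * (iso i v).1 ∧
      (iso j (veech i v)).2 = (iso i v).1) ∨
    ((iso j (veech i v)).1 = (iso i v).1 ∧
      (iso j (veech i v)).2 = (iso i v).2 - 3 * (iso i v).1) := by
  rw [iso_veech]
  fin_cases j <;> simp

/-- The additive continued fraction algorithm on the first sector contracts to `0` if it never
meets the boundary of a sector. -/
theorem exists_add_lt {a c : ℕ → ℝ} (ha : ∀ k, 0 < a k) (hac : ∀ k, a k < c k)
    (hrec : ∀ k, (a (k + 1) = a k ∧ c (k + 1) = 2 * a k - c k) ∨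
      (a (k + 1) = 2 * a k - c k ∧ c (k + 1) = a k) ∨
      (a (k + 1) = c k - 2 * a k ∧ c (k + 1) = 3 * a k - c k) ∨
      (a (k + 1) = 3 * a k - c k ∧ c (k + 1) = c k - 2 * a k) ∨
      (a (k + 1) = c k - 3 * a k ∧ c (k + 1) = a k) ∨
      (a (k + 1) = a k ∧ c (k + 1) = c k - 3 * a k)) {ε : ℝ} (hε : 0 < ε) :
    ∃ k, a k + c k < ε := by
  by_contra hno
  push Not at hno
  have hanti : Antitone fun k => a k + c k := by
    refine antitone_nat_of_succ_le fun k => ?_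
    have := ha k
    have := hac k
    have := ha (k + 1)
    have := hac (k + 1)
    rcases hrec k with ⟨e, f⟩ | ⟨e, f⟩ | ⟨e, f⟩ | ⟨e, f⟩ | ⟨e, f⟩ | ⟨e, f⟩ <;> linarith
  -- The sums decrease and are bounded below by `ε`, so their decrements eventually become
  -- negligible.
  obtain ⟨K, hK⟩ : ∃ K, ∀ k, K ≤ k → (a k + c k) - (a (k + 1) + c (k + 1)) ≤ ε / 100 := by
    have hbdd : BddBelow (Set.range fun k => a k + c k) :=
      ⟨ε, by rintro _ ⟨k, rfl⟩; exact hno k⟩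
    obtain ⟨K, hK⟩ := exists_lt_of_ciInf_lt
      (show (⨅ k, (a k + c k)) < (⨅ k, (a k + c k)) + ε / 100 by linarith)
    refine ⟨K, fun k hk => ?_⟩
    have h1 := hanti hk
    have h2 := ciInf_le hbdd (k + 1)
    simp only at h1 h2
    linarith
  -- Only the last branch, losing `3 * a`, and the second, losing `2 * (c - a)`, can lose so little
  -- while the sum stays at least `ε`. Either of them then repeats forever, subtracting a fixed
  -- positive amount from a positive number.
  have hstart : 3 * a K ≤ ε / 100 ∨ 2 * (c K - a K) ≤ ε / 100 := by
    have := ha K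
    have := hac K
    have := ha (K + 1)
    have := hac (K + 1)
    have := hno K
    have := hK K le_rfl
    rcases hrec K with ⟨e, f⟩ | ⟨e, f⟩ | ⟨e, f⟩ | ⟨e, f⟩ | ⟨e, f⟩ | ⟨e, f⟩
    · exfalso; linarith
    · right; linarith
    · exfalso; linarith
    · exfalso; linarith
    · exfalso; linarith
    · left; linarith
  rcases hstart with h0 | h0
  · have key : ∀ m : ℕ, a (K + m) = a K ∧ c (K + m) = c K - m * (3 * a K) := by
      intro m
      induction m with
      | zero => simp
      | succ m ih =>
        obtain ⟨h1, h2⟩ := ih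
        have := ha (K + m + 1)
        have := hac (K + m + 1)
        have := hno (K + m)
        rw [show K + (m + 1) = K + m + 1 by ring]
        rcases hrec (K + m) with ⟨e, f⟩ | ⟨e, f⟩ | ⟨e, f⟩ | ⟨e, f⟩ | ⟨e, f⟩ | ⟨e, f⟩
        · exfalso; linarith
        · exfalso; linarith
        · exfalso; linarith
        · exfalso; linarith
        · exfalso; linarith
        · exact ⟨by linarith, by push_cast; linarith⟩
    obtain ⟨m, hm⟩ := exists_nat_gt (c K / (3 * a K))
    rw [div_lt_iff₀ (by linarith [ha K])] at hm
    have := (key m).2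
    linarith [ha (K + m), hac (K + m)]
  · have key : ∀ m : ℕ, a (K + m) = a K - m * (c K - a K) ∧ c (K + m) - a (K + m) = c K - a K := by
      intro m
      induction m with
      | zero => simp
      | succ m ih =>
        obtain ⟨h1, h2⟩ := ih
        have := ha (K + m + 1)
        have := hac (K + m + 1)
        have := hac (K + m)
        have := hno (K + m)
        rw [show K + (m + 1) = K + m + 1 by ring]
        rcases hrec (K + m) with ⟨e, f⟩ | ⟨e, f⟩ | ⟨e, f⟩ | ⟨e, f⟩ | ⟨e, f⟩ | ⟨e, f⟩
        · exfalso; linarith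
        · exact ⟨by push_cast; linarith, by linarith⟩
        · exfalso; linarith
        · exfalso; linarith
        · exfalso; linarith
        · exfalso; linarith
    obtain ⟨m, hm⟩ := exists_nat_gt (a K / (c K - a K))
    rw [div_lt_iff₀ (by linarith [hac K])] at hm
    have := (key m).1
    linarith [ha (K + m)]

/-- Two vectors with the same infinite itinerary, one of which stays in the interiors of the
sectors, are parallel. -/
theorem cross_eq_zero_of_itinerary {s : ℕ → Fin 6} {V V' : ℕ → ℝ × ℝ}
    (hV : ∀ k, V (k + 1) = veech (s k) (V k)) (hV' : ∀ k, V' (k + 1) = veech (s k) (V' k))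
    (h : ∀ k, 0 < (iso (s k) (V k)).1 ∧ (iso (s k) (V k)).1 < (iso (s k) (V k)).2)
    (h' : ∀ k, 0 ≤ (iso (s k) (V' k)).1 ∧ (iso (s k) (V' k)).1 ≤ (iso (s k) (V' k)).2) :
    cross (V 0) (V' 0) = 0 := by
  have recV := fun k => iso_veech_cases (s k) (s (k + 1)) (V k)
  have recV' := fun k => iso_veech_cases (s k) (s (k + 1)) (V' k)
  simp only [← hV] at recV
  simp only [← hV'] at recV'
  have hconst : ∀ k, |cross (V k) (V' k)| = |cross (V 0) (V' 0)| := by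
    intro k
    induction k with
    | zero => rfl
    | succ k ih => rw [hV, hV', cross_veech, ih]
  have hS' : Antitone fun k => (iso (s k) (V' k)).1 + (iso (s k) (V' k)).2 := by
    refine antitone_nat_of_succ_le fun k => ?_
    have := h' k
    have := h' (k + 1)
    rcases recV' k with ⟨e, f⟩ | ⟨e, f⟩ | ⟨e, f⟩ | ⟨e, f⟩ | ⟨e, f⟩ | ⟨e, f⟩ <;> linarith
  by_contra h0
  obtain ⟨M, hM⟩ : ∃ M, M = (iso (s 0) (V' 0)).1 + (iso (s 0) (V' 0)).2 := ⟨_, rfl⟩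
  have hM0 : 0 ≤ M := by have := h' 0; linarith
  -- `M + 1` replaces `M`, which may be zero, as the divisor.
  obtain ⟨k, hk⟩ := exists_add_lt (fun k => (h k).1) (fun k => (h k).2) recV
    (div_pos (abs_pos.2 h0) (by linarith : 0 < M + 1))
  rw [lt_div_iff₀ (by linarith), ← hconst k, ← cross_iso (s k)] at hk
  have h1 := h k
  have h2 := h' k
  have h3 := hS' (Nat.zero_le k)
  simp only [← hM] at h3
  generalize iso (s k) (V k) = v at *
  generalize iso (s k) (V' k) = v' at *
  have h4 : |cross v v'| ≤ (v.1 + v.2) * M := by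
    have p1 : 0 ≤ v.1 * v'.1 := mul_nonneg h1.1.le h2.1
    have p2 : 0 ≤ v.2 * v'.2 := mul_nonneg (by linarith) (by linarith)
    have p3 : 0 ≤ v.1 * v'.2 := mul_nonneg (by linarith) (by linarith)
    have p4 : 0 ≤ v.2 * v'.1 := mul_nonneg (by linarith) (by linarith)
    have p5 : (v.1 + v.2) * (v'.1 + v'.2) ≤ (v.1 + v.2) * M :=
      mul_le_mul_of_nonneg_left h3 (by linarith)
    rw [abs_le, cross]
    constructor <;> nlinarith
  nlinarith

/-! ### The Farey map in coordinates -/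

/-- The coordinates of the unit vector with angle `θ`. -/
def ang (θ : ℝ) : ℝ × ℝ := coord (Real.cos θ, Real.sin θ)

theorem coord_smul (r : ℝ) (u : ℝ × ℝ) : coord (r • u) = r • coord u := by
  ext <;> simp [coord]
  ring

theorem coord_gam_nu (i : Fin 6) (u : ℝ × ℝ) :
    coord (((gam * nu i).mulVec ![u.1, u.2]) 0, ((gam * nu i).mulVec ![u.1, u.2]) 1) =
      veech i (coord u) := by
  have h3 := sqrt_three_sq
  have h33 : √3 ^ 3 = 3 * √3 := by rw [pow_succ, h3]
  fin_cases i <;> ext <;>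
    simp [coord, veech, iso, gam, nu, Matrix.mul_apply, Matrix.mulVec, dotProduct,
      Fin.sum_univ_two] <;> ring_nf <;> (try simp only [h3, h33]) <;> ring

theorem coord_eq_zero {u : ℝ × ℝ} (h : coord u = 0) : u = 0 := by
  have h1 := congrArg Prod.fst h
  have h2 := congrArg Prod.snd h
  simp only [coord, Prod.fst_zero, Prod.snd_zero] at h1 h2
  rw [h1] at h2
  have := sqrt_three_pos
  have h4 : u.1 = 0 := by
    have : √3 / 2 * u.1 = 0 := by linarith
    exact (mul_eq_zero.1 this).resolve_left (by positivity)
  exact Prod.ext h4 h1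

theorem iso_eq_zero {i : Fin 6} {v : ℝ × ℝ} (h : iso i v = 0) : v = 0 := by
  have h1 := congrArg Prod.fst h
  have h2 := congrArg Prod.snd h
  fin_cases i <;> simp [iso] at h1 h2 <;> ext <;> simp <;> linarith

theorem veech_eq_zero {i : Fin 6} {v : ℝ × ℝ} (h : veech i v = 0) : v = 0 := by
  have h1 := congrArg Prod.fst h
  have h2 := congrArg Prod.snd h
  simp only [veech, Prod.fst_zero, Prod.snd_zero] at h1 h2
  exact iso_eq_zero (i := i) (Prod.ext h1 (by simp; linarith))

/-- The polar form of a vector. -/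
theorem exists_polar {u : ℝ × ℝ} (hu : u ≠ 0) : ∃ r : ℝ, 0 < r ∧
    u = r • (Real.cos (Complex.arg ⟨u.1, u.2⟩), Real.sin (Complex.arg ⟨u.1, u.2⟩)) := by
  refine ⟨‖(⟨u.1, u.2⟩ : ℂ)‖, norm_pos_iff.2 fun h => hu ?_, ?_⟩
  · exact Prod.ext (congrArg Complex.re h) (congrArg Complex.im h)
  · ext
    · simp [Complex.norm_mul_cos_arg]
    · simp [Complex.norm_mul_sin_arg]

theorem cos_sin_ne_zero (θ : ℝ) : ((Real.cos θ, Real.sin θ) : ℝ × ℝ) ≠ 0 := fun h => by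
  have h1 := congrArg Prod.fst h
  have h2 := congrArg Prod.snd h
  simp only [Prod.fst_zero, Prod.snd_zero] at h1 h2
  have := Real.sin_sq_add_cos_sq θ
  rw [h1, h2] at this
  norm_num at this

theorem ang_fareyBranch (i : Fin 6) (θ : ℝ) :
    ∃ r : ℝ, 0 < r ∧ veech i (ang θ) = r • ang (fareyBranch i θ) := by
  have e := coord_gam_nu i (Real.cos θ, Real.sin θ)
  obtain ⟨r, hr, h⟩ := exists_polar (u := (((gam * nu i).mulVec ![Real.cos θ, Real.sin θ]) 0,
    ((gam * nu i).mulVec ![Real.cos θ, Real.sin θ]) 1)) (by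
      intro h0
      simp only [h0] at e
      have : coord (0 : ℝ × ℝ) = 0 := by simp [coord]
      rw [this] at e
      exact cos_sin_ne_zero θ (coord_eq_zero (veech_eq_zero e.symm)))
  refine ⟨r, hr, ?_⟩
  rw [ang, ← e]
  simp only
  rw [h, coord_smul]
  rfl

theorem fareyBranch_mem_Icc {i : Fin 6} {θ : ℝ} (h : 0 ≤ (iso i (ang θ)).1) :
    fareyBranch i θ ∈ Set.Icc 0 Real.pi := by
  have e := congrArg Prod.fst (coord_gam_nu i (Real.cos θ, Real.sin θ))
  refine ⟨Complex.arg_nonneg_iff.2 ?_, Complex.arg_le_pi _⟩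
  simp only [coord, veech] at e ⊢
  rw [e]
  exact h

/-- On angles, `nu i` acts as a rotation or reflection, and the listed one folds sector `i` onto
sector `0`. -/
theorem iso_ang (i : Fin 6) (θ : ℝ) :
    iso i (ang θ) = ang (![θ, Real.pi / 3 - θ, θ - Real.pi / 3, 2 * (Real.pi / 3) - θ,
      θ - 2 * (Real.pi / 3), Real.pi - θ] i) := by
  have h3 := sqrt_three_sq
  have c2 : Real.cos (2 * (Real.pi / 3)) = -1 / 2 := by
    rw [Real.cos_two_mul, Real.cos_pi_div_three]; norm_num
  have s2 : Real.sin (2 * (Real.pi / 3)) = √3 / 2 := by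
    rw [Real.sin_two_mul, Real.cos_pi_div_three, Real.sin_pi_div_three]; ring
  fin_cases i <;> ext <;>
    simp [iso, ang, coord, Real.cos_sub, Real.sin_sub, c2, s2] <;> ring_nf <;> (try simp only [h3]) <;>
    ring

theorem ang_cone {φ : ℝ} (h0 : 0 ≤ φ) (h1 : φ ≤ Real.pi / 6) :
    0 ≤ (ang φ).1 ∧ (ang φ).1 ≤ (ang φ).2 := by
  have hpi := Real.pi_pos
  have k1 := Real.sin_nonneg_of_nonneg_of_le_pi h0 (by linarith)
  -- The second minus the first coordinate of `ang φ` is `√3 * sin (π / 6 - φ)`.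
  have k2 := Real.sin_nonneg_of_nonneg_of_le_pi (x := Real.pi / 6 - φ) (by linarith) (by linarith)
  rw [Real.sin_sub, Real.sin_pi_div_six, Real.cos_pi_div_six] at k2
  refine ⟨k1, ?_⟩
  simp only [ang, coord]
  have := mul_nonneg sqrt_three_pos.le k2
  nlinarith [sqrt_three_sq]

theorem iso_ang_cone {i : Fin 6} {θ : ℝ} (h : θ ∈ sector i) :
    0 ≤ (iso i (ang θ)).1 ∧ (iso i (ang θ)).1 ≤ (iso i (ang θ)).2 := by
  rw [iso_ang]
  obtain ⟨h1, h2⟩ := h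
  fin_cases i <;> simp at h1 h2 ⊢ <;> exact ang_cone (by linarith) (by linarith)

theorem sector_subset (i : Fin 6) : sector i ⊆ Set.Icc 0 Real.pi := by
  have hpi := Real.pi_pos
  rintro θ ⟨h1, h2⟩
  fin_cases i <;> simp at h1 h2 <;> constructor <;> linarith

theorem mem_sector_sectorIndex {θ : ℝ} (h : θ ∈ Set.Icc 0 Real.pi) :
    θ ∈ sector (sectorIndex θ) := by
  obtain ⟨h1, h2⟩ := h
  unfold sectorIndex
  split_ifs <;> constructor <;> simp <;> linarith

/-! ### Renormalization -/

theorem Irr.of_iso {v : ℝ × ℝ} {i : Fin 6} (h : Irr (HexCut.iso i v)) : Irr v := by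
  intro m n e
  fin_cases i
  · exact h m n e
  · have := h n m (by push_cast; simp [HexCut.iso]; linear_combination e)
    omega
  · have := h (m - n) m (by push_cast; simp [HexCut.iso]; linear_combination e)
    omega
  · have := h m (m - n) (by push_cast; simp [HexCut.iso]; linear_combination e)
    omega
  · have := h (-n) (m - n) (by push_cast; simp [HexCut.iso]; linear_combination e)
    omega
  · have := h (m - n) (-n) (by push_cast; simp [HexCut.iso]; linear_combination e)
    omega

theorem Irr.veech {v : ℝ × ℝ} (h : Irr v) (i : Fin 6) : Irr (veech i v) := by
  intro m n e
  simp only [HexCut.veech] at e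
  have := h.iso i (m + 2 * n) (-n) (by push_cast; linear_combination e)
  omega

/-- `w` codes a trajectory in the irrational direction `θ` or `θ + π`. -/
structure CodesDirection (w : Word) (θ : ℝ) : Prop where
  mem : θ ∈ Set.Icc 0 Real.pi
  irr : Irr (ang θ)
  orbit : ∃ x, IsOrbit (ang θ).1 (ang θ).2 w x

namespace CodesDirection

variable {w : Word} {θ : ℝ}

/-- Equality in either inequality of the closed cone would be a rational relation. -/
theorem cone (h : CodesDirection w θ) :
    0 < (iso (sectorIndex θ) (ang θ)).1 ∧
      (iso (sectorIndex θ) (ang θ)).1 < (iso (sectorIndex θ) (ang θ)).2 := by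
  have h1 := iso_ang_cone (mem_sector_sectorIndex h.mem)
  have h2 := h.irr.iso (sectorIndex θ)
  have h3 := h2.ne_zero (m := 1) (n := 0) (by decide)
  have h4 := h2.ne_zero (m := 1) (n := -1) (by decide)
  push_cast at h3 h4
  exact ⟨lt_of_le_of_ne h1.1 fun e => h3 (by linarith),
    lt_of_le_of_ne h1.2 fun e => h4 (by linarith)⟩

theorem admissible_iff (h : CodesDirection w θ) (j : Fin 6) :
    Admissible j w ↔ j = sectorIndex θ := by
  obtain ⟨x, hx⟩ := h.orbit
  obtain ⟨y, hy⟩ := hx.relabel (sectorIndex θ)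
  exact hy.admissible_iff h.cone.1 h.cone.2 (h.irr.iso _) j

theorem exists_isDerived (h : CodesDirection w θ) :
    ∃ w', IsDerived (HexCut.relabel (sectorIndex θ) w) w' := by
  obtain ⟨x, hx⟩ := h.orbit
  obtain ⟨y, hy⟩ := hx.relabel (sectorIndex θ)
  exact hy.exists_isDerived h.cone.1 h.cone.2

theorem of_isDerived (h : CodesDirection w θ) {w' : Word}
    (hw : IsDerived (HexCut.relabel (sectorIndex θ) w) w') : CodesDirection w' (fareyMap θ) := by
  obtain ⟨x, hx⟩ := h.orbit
  obtain ⟨y, hy⟩ := hx.relabel (sectorIndex θ)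
  have hi := h.irr.iso (sectorIndex θ)
  have h2 := hi.ne_zero (m := -2) (n := 1) (by decide)
  have h3 := hi.ne_zero (m := -3) (n := 1) (by decide)
  push_cast at h2 h3
  obtain ⟨z, hz⟩ := hy.of_isDerived h.cone.1 h.cone.2 (fun e => h2 (by linarith))
    (fun e => h3 (by linarith)) hw
  obtain ⟨r, hr, e⟩ := ang_fareyBranch (sectorIndex θ) θ
  have e' : ang (fareyMap θ) = r⁻¹ • veech (sectorIndex θ) (ang θ) := by
    rw [e, smul_smul, inv_mul_cancel₀ hr.ne', one_smul]; rfl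
  refine ⟨fareyBranch_mem_Icc h.cone.1.le, ?_, ?_⟩
  · rw [e']
    exact (h.irr.veech _).smul (inv_ne_zero hr.ne')
  · rw [e']
    exact ⟨_, IsOrbit.smul hz (inv_pos.2 hr)⟩

/-- Digit `0` would mean `a < 2 * a - c`, contradicting `a < c`. -/
theorem sectorIndex_fareyMap_ne_zero (h : CodesDirection w θ) {w' : Word}
    (hw : IsDerived (HexCut.relabel (sectorIndex θ) w) w') : sectorIndex (fareyMap θ) ≠ 0 := by
  intro h0
  have h1 := (h.of_isDerived hw).cone
  rw [h0] at h1
  obtain ⟨r, hr, e⟩ := ang_fareyBranch (sectorIndex θ) θ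
  have e1 := congrArg Prod.fst e
  have e2 := congrArg Prod.snd e
  change (iso _ _).1 = r * (iso 0 (ang (fareyMap θ))).1 at e1
  change 2 * (iso _ _).1 - (iso _ _).2 = r * (iso 0 (ang (fareyMap θ))).2 at e2
  have h2 := h.cone
  have := mul_lt_mul_of_pos_left h1.2 hr
  linarith

/-- The words of the recursive construction in `IsDiagramSequence`. -/
theorem iterate {d : ℕ → Fin 6} {W : ℕ → Word} (h : CodesDirection (W 0) θ)
    (hW : ∀ k, (∀ i, Admissible i (W k) ↔ i = d k) ∧
      IsDerived (HexCut.relabel (d k) (W k)) (W (k + 1))) (k : ℕ) :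
    CodesDirection (W k) (fareyMap^[k] θ) ∧ d k = sectorIndex (fareyMap^[k] θ) := by
  have key : ∀ k, CodesDirection (W k) (fareyMap^[k] θ) → d k = sectorIndex (fareyMap^[k] θ) :=
    fun k hk => (hk.admissible_iff _).1 (((hW k).1 _).2 rfl)
  induction k with
  | zero => exact ⟨h, key 0 h⟩
  | succ k ih =>
    have h1 := (hW k).2
    rw [ih.2] at h1
    have h2 := ih.1.of_isDerived h1
    rw [← Function.iterate_succ_apply' fareyMap] at h2
    exact ⟨h2, key _ h2⟩

theorem exists_words (h : CodesDirection w θ) :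
    ∃ W : ℕ → Word, W 0 = w ∧ ∀ k, CodesDirection (W k) (fareyMap^[k] θ) ∧
      IsDerived (HexCut.relabel (sectorIndex (fareyMap^[k] θ)) (W k)) (W (k + 1)) := by
  classical
  let next : Word → ℝ → Word := fun v φ =>
    if hv : CodesDirection v φ then hv.exists_isDerived.choose else v
  have hnext : ∀ {v φ}, CodesDirection v φ →
      IsDerived (HexCut.relabel (sectorIndex φ) v) (next v φ) := by
    intro v φ hv
    simp only [next, dif_pos hv]
    exact hv.exists_isDerived.choose_spec
  let W : ℕ → Word := fun k => Nat.rec w (fun k v => next v (fareyMap^[k] θ)) k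
  have hW : ∀ k, CodesDirection (W k) (fareyMap^[k] θ) := by
    intro k
    induction k with
    | zero => exact h
    | succ k ih =>
      have := ih.of_isDerived (hnext ih)
      rwa [← Function.iterate_succ_apply' fareyMap] at this
  exact ⟨W, rfl, fun k => ⟨hW k, hnext (hW k)⟩⟩

theorem isDiagramSequence_iff (h : CodesDirection w θ) (d : ℕ → Fin 6) :
    IsDiagramSequence w d ↔ d = fun k => sectorIndex (fareyMap^[k] θ) := by
  constructor
  · rintro ⟨W, rfl, hW⟩
    exact funext fun k => (iterate h hW k).2
  · rintro rfl
    obtain ⟨W, h0, hW⟩ := h.exists_words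
    exact ⟨W, h0, fun k => ⟨(hW k).1.admissible_iff, (hW k).2⟩⟩

end CodesDirection

/-! ### Cylinders and the Farey expansion -/

/-- The images of `θ` under the branches of the Farey map prescribed by `s`. -/
def branchIterate (s : ℕ → Fin 6) (θ : ℝ) : ℕ → ℝ
  | 0 => θ
  | k + 1 => fareyBranch (s k) (branchIterate s θ k)

theorem branchIterate_succ (s : ℕ → Fin 6) (θ : ℝ) (k : ℕ) :
    branchIterate s θ (k + 1) =
      branchIterate (fun j => s (j + 1)) (fareyBranch (s 0) θ) k := by
  induction k with
  | zero => rfl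
  | succ k ih => rw [branchIterate, ih, branchIterate]

theorem mem_cylinder_of_forall {s : ℕ → Fin 6} {θ : ℝ}
    (h : ∀ k, branchIterate s θ k ∈ sector (s k)) (k : ℕ) : θ ∈ cylinder k s := by
  induction k generalizing s θ with
  | zero => exact ⟨h 0, sector_subset _ (h 1)⟩
  | succ k ih => exact ⟨h 0, ih fun j => branchIterate_succ s θ j ▸ h (j + 1)⟩

theorem forall_of_mem_cylinder {s : ℕ → Fin 6} {θ : ℝ} {k : ℕ} (h : θ ∈ cylinder k s) :
    branchIterate s θ k ∈ sector (s k) := by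
  induction k generalizing s θ with
  | zero => exact h.1
  | succ k ih =>
    rw [branchIterate_succ]
    exact ih (s := fun j => s (j + 1)) h.2

theorem exists_smul_ang_branchIterate (s : ℕ → Fin 6) (θ : ℝ) {V : ℕ → ℝ × ℝ}
    (h0 : V 0 = ang θ) (hV : ∀ k, V (k + 1) = veech (s k) (V k)) (k : ℕ) :
    ∃ r : ℝ, 0 < r ∧ V k = r • ang (branchIterate s θ k) := by
  induction k with
  | zero => exact ⟨1, one_pos, by rw [h0, one_smul]; rfl⟩
  | succ k ih =>
    obtain ⟨r, hr, e⟩ := ih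
    obtain ⟨r', hr', e'⟩ := ang_fareyBranch (s k) (branchIterate s θ k)
    exact ⟨r * r', mul_pos hr hr', by rw [hV, e, veech_smul, e', smul_smul]; rfl⟩

theorem cross_ang (θ φ : ℝ) : cross (ang θ) (ang φ) = √3 / 2 * Real.sin (θ - φ) := by
  simp only [cross, ang, coord, Real.sin_sub]; ring

theorem CodesDirection.hasFareyExpansion {w : Word} {θ : ℝ} (h : CodesDirection w θ) :
    HasFareyExpansion θ (fun k => sectorIndex (fareyMap^[k] θ)) := by
  obtain ⟨W, h0, hW⟩ := h.exists_words
  obtain ⟨s, hs⟩ : ∃ s : ℕ → Fin 6, s = fun k => sectorIndex (fareyMap^[k] θ) := ⟨_, rfl⟩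
  have hs' : ∀ k, s k = sectorIndex (fareyMap^[k] θ) := fun k => by rw [hs]
  rw [← hs]
  have hmem : ∀ k, fareyMap^[k] θ ∈ sector (s k) := fun k => by
    rw [hs']; exact mem_sector_sectorIndex (hW k).1.mem
  have hb : ∀ k, branchIterate s θ k = fareyMap^[k] θ := by
    intro k
    induction k with
    | zero => rfl
    | succ k ih => rw [branchIterate, ih, hs', Function.iterate_succ_apply']; rfl
  refine ⟨fun k hk => ?_, hmem, ?_⟩
  · obtain ⟨k, rfl⟩ : ∃ j, k = j + 1 := ⟨k - 1, by omega⟩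
    rw [hs', Function.iterate_succ_apply']
    exact (hW k).1.sectorIndex_fareyMap_ne_zero (hW k).2
  · ext φ
    simp only [Set.mem_iInter, Set.mem_singleton_iff]
    constructor
    · intro hφ
      let V : ℝ → ℕ → ℝ × ℝ := fun t k => Nat.rec (ang t) (fun k v => veech (s k) v) k
      have hc : cross (V θ 0) (V φ 0) = 0 := by
        refine cross_eq_zero_of_itinerary (s := s) (fun k => rfl) (fun k => rfl)
          (fun k => ?_) (fun k => ?_)
        · obtain ⟨r, hr, e⟩ := exists_smul_ang_branchIterate s θ (V := V θ) rfl (fun k => rfl) k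
          have hk := (hW k).1.cone
          rw [e, iso_smul, hb, hs']
          exact ⟨mul_pos hr hk.1, mul_lt_mul_of_pos_left hk.2 hr⟩
        · obtain ⟨r, hr, e⟩ := exists_smul_ang_branchIterate s φ (V := V φ) rfl (fun k => rfl) k
          have hk := iso_ang_cone (forall_of_mem_cylinder (hφ k))
          rw [e, iso_smul]
          exact ⟨mul_nonneg hr.le hk.1, mul_le_mul_of_nonneg_left hk.2 hr.le⟩
      change cross (ang θ) (ang φ) = 0 at hc
      rw [cross_ang] at hc
      have hsin : Real.sin (θ - φ) = 0 :=
        (mul_eq_zero.1 hc).resolve_left (by have := sqrt_three_pos; positivity)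
      have hφm := sector_subset _ (forall_of_mem_cylinder (hφ 0))
      change φ ∈ _ at hφm
      -- Independence excludes the horizontal direction, so `θ - φ` lies strictly between `-π` and
      -- `π`, where the sine vanishes only at `0`.
      have hsθ : Real.sin θ ≠ 0 := by
        have := h.irr.ne_zero (m := 1) (n := 0) (by decide)
        simpa [ang, coord] using this
      have hθ0 : 0 < θ := lt_of_le_of_ne h.mem.1 fun e => hsθ (by rw [← e, Real.sin_zero])
      have hθ1 : θ < Real.pi := lt_of_le_of_ne h.mem.2 fun e => hsθ (by rw [e, Real.sin_pi])
      have := (Real.sin_eq_zero_iff_of_lt_of_lt (by linarith [hφm.2]) (by linarith [hφm.1])).1 hsin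
      linarith
    · rintro rfl
      exact mem_cylinder_of_forall fun k => by rw [hb]; exact hmem k

theorem isPeriodic_of_relabel {i : Fin 6} {w : Word} (h : IsPeriodic (relabel i w)) :
    IsPeriodic w := by
  obtain ⟨p, hp, h⟩ := h
  exact ⟨p, hp, fun n => (labelPerm i).injective (h n)⟩

theorem LinearTrajectory.exists_codesDirection (τ : LinearTrajectory)
    (hτ : ¬ IsPeriodic τ.cuttingSequence) :
    ∃ θ, CodesDirection τ.cuttingSequence θ ∧ (τ.HasDirection θ ∨ τ.HasDirection (θ + Real.pi)) := by
  have horb := τ.isOrbit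
  suffices H : ∃ θ ∈ Set.Icc 0 Real.pi, (∃ x, IsOrbit (ang θ).1 (ang θ).2 τ.label x) ∧
      (τ.HasDirection θ ∨ τ.HasDirection (θ + Real.pi)) by
    obtain ⟨θ, hθ, ⟨x, hx⟩, hdir⟩ := H
    refine ⟨θ, ⟨hθ, ?_, x, hx⟩, hdir⟩
    have hc := iso_ang_cone (mem_sector_sectorIndex hθ)
    obtain ⟨y, hy⟩ := hx.relabel (sectorIndex θ)
    exact Irr.of_iso (hy.irr_of_not_isPeriodic hc.1 hc.2 fun hp => hτ (isPeriodic_of_relabel (i := sectorIndex θ) hp))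
  obtain ⟨r, hr, e⟩ := exists_polar τ.dir_ne_zero
  -- The argument lies in `(-π, π]`; a negative one is moved into `[0, π]` by adding `π`, which
  -- `IsOrbit.neg` permits.
  set φ := Complex.arg ⟨τ.dir.1, τ.dir.2⟩ with hφ
  have hang : ang φ = r⁻¹ • coord τ.dir := by
    rw [e, coord_smul, smul_smul, inv_mul_cancel₀ hr.ne', one_smul]; rfl
  have hx := IsOrbit.smul horb (inv_pos.2 hr)
  have hx' : ∃ x, IsOrbit (ang φ).1 (ang φ).2 τ.label x := by
    rw [hang]; exact ⟨_, hx⟩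
  rcases le_or_gt 0 φ with h0 | h0
  · refine ⟨φ, ⟨h0, Complex.arg_le_pi _⟩, hx', Or.inl ⟨r, hr, e⟩⟩
  · refine ⟨φ + Real.pi, ⟨by linarith [Complex.neg_pi_lt_arg ⟨τ.dir.1, τ.dir.2⟩], by linarith⟩,
      ?_, Or.inr ⟨r, hr, ?_⟩⟩
    · obtain ⟨x, hx'⟩ := hx'
      refine ⟨x, ?_⟩
      have : ang (φ + Real.pi) = -ang φ := by
        ext <;> simp [ang, coord]
        ring
      rw [this]
      exact hx'.neg
    · rw [Real.cos_add_pi, Real.cos_add_pi, Real.sin_add_pi, Real.sin_add_pi, neg_neg, neg_neg]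
      exact e

end HexCut

end

theorem mainTheorem5 (w : HexCut.Word) (hw : HexCut.IsCuttingSequence w)
    (hnp : ¬ HexCut.IsPeriodic w) :
    (∃! d : ℕ → Fin 6, HexCut.IsDiagramSequence w d) ∧
    ∀ d : ℕ → Fin 6, HexCut.IsDiagramSequence w d →
      ∃ θ ∈ Set.Icc (0 : ℝ) Real.pi,
        HexCut.HasFareyExpansion θ d ∧
        (∃ τ : HexCut.LinearTrajectory, τ.cuttingSequence = w ∧ τ.HasDirection θ) ∧
        ∀ τ : HexCut.LinearTrajectory, τ.cuttingSequence = w →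
          τ.HasDirection θ ∨ τ.HasDirection (θ + Real.pi) := by
  obtain ⟨τ, rfl⟩ := hw
  obtain ⟨θ, hθ, -⟩ := τ.exists_codesDirection hnp
  have hd := hθ.isDiagramSequence_iff
  refine ⟨⟨_, (hd _).2 rfl, fun d h => (hd d).1 h⟩, fun d h => ?_⟩
  obtain rfl := (hd d).1 h
  refine ⟨θ, hθ.mem, hθ.hasFareyExpansion, ?_, fun τ' hτ' => ?_⟩
  · obtain ⟨x, hx⟩ := hθ.orbit
    obtain ⟨τ', h1, h2⟩ := HexCut.IsOrbit.exists_trajectory (HexCut.cos_sin_ne_zero θ) hx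
    exact ⟨τ', h1, 1, one_pos, by rw [h2, one_mul, one_mul]⟩
  · obtain ⟨φ, hφ, hdir⟩ := τ'.exists_codesDirection (hτ' ▸ hnp)
    rw [hτ'] at hφ
    -- The two angles have the same digits, hence the same cylinders, whose intersection is a single
    -- point.
    have e := (hφ.isDiagramSequence_iff _).1 h
    have h1 := hφ.hasFareyExpansion.2.2
    rw [← e, hθ.hasFareyExpansion.2.2, Set.singleton_eq_singleton_iff] at h1
    rw [h1]
    exact hdir
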